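/- **Setting.** Let $J^6$ be the space with coordinates $(Z,W,W^*,R,s,s^*)$, where $Z,R$ are real and $W^*,s^*$ are the complex conjugates of the complex coordinates $W,s$; on functions and forms, ${}^*$ denotes complex conjugation. Let $U\subset J^6$ be open and let $S:U\to\mathbb C$ be smooth with $1-S_RS^*_R>0$. Let $T,T^*$ be the solution of the linear system $T=D^*S$, $T^*=DS^*$, where $$D=e_s=\partial_s+W\partial_Z+S\partial_W+R\partial_{W^*}+T\partial_R,\qquad D^*=e_{s^*}=\partial_{s^*}+W^*\partial_Z+R\partial_W+S^*\partial_{W^*}+T^*\partial_R .$$ Assume the integrability condition $D^2S^*=D^{*2}S$ on $U$. The associated equations for a real function $Z(s,s^*)$ are $Z_{ss}=S$, $Z_{s^*s^*}=S^*$ (evaluated at $(Z,Z_s,Z_{s^*},Z_{ss^*},s,s^*)$). The *solution space* of an open $V\subset U$ is the quotient of $V$ by the equivalence relation generated by: $p\sim q$ if $p$ and $q$ lie on the lift $s\mapsto(Z,Z_s,Z_{s^*},Z_{ss^*},s,s^*)$, contained in $V$, of one smooth solution $Z$ with connected open domain. Put $\beta^0=dZ-W\,ds-W^*ds^*$, $\beta^+=dW-S\,ds-R\,ds^*$,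 $\beta^-=dW^*-R\,ds-S^*ds^*$, $\beta^1=dR-T\,ds-T^*ds^*$. For smooth functions $\alpha,c$ (real) and $a,b$ (complex) on $U$ with $\alpha\neq0$, $1-bb^*\ne0$, and for a nowhere vanishing smooth real function $\Phi$ (the conformal parameter), put $$\theta^0=\Phi\beta^0,\quad \theta^\pm=\Phi\hat\theta^\pm,\quad \hat\theta^+=\alpha(\beta^++b\beta^-),\quad \hat\theta^-=\alpha(\beta^-+b^*\beta^+),\quad \theta^1=\Phi(\beta^1+a\beta^++a^*\beta^-+c\beta^0).$$ Let $e_0,e_1,e_+,e_-,e_s,e_{s^*}$ be the frame dual to $\theta^0,\theta^1,\theta^+,\theta^-,ds,ds^*$, let $\Delta^i{}_{JK}=d\theta^i(e_J,e_K)$, and let $\hat\Delta^i{}_{JK}$ be these coefficients for $\Phi=1$. Let $\eta_{ij}$ be the constant matrix with $\eta_{01}=\eta_{10}=1$, $\eta_{+-}=\eta_{-+}=-1$ and all other entries $0$, and $g=\eta_{ij}\theta^i\otimes\theta^j$. A *torsion-free generalized Weyl connection* for $\theta$ is a family of one-forms $\omega_{ij}$ on the six-dimensional space with $d\theta^i+\eta^{ij}\omega_{jk}\wedge\theta^k=0$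 and $\omega_{(ij)}=\eta_{ij}A$ for a one-form $A$ (the Weyl one-form); write $A_s=A(e_s)$, $A_{s^*}=A(e_{s^*})$. Forms and vector fields are complex-valued, and the Lie derivative is extended complex-linearly to complex vector fields. Assume that $\alpha,a,b,c$ are such that a torsion-free generalized Weyl connection exists on $U$ for the tetrad with $\Phi=1$. **Statement.** Consider the equations $$D\Phi=\tfrac14\hat\Delta^k{}_{ks}\Phi,\qquad D^*\Phi=\tfrac14\hat\Delta^k{}_{ks^*}\Phi. \tag{1}$$ 1. (Existence.) Every point of $U$ has an open neighbourhood $V\subset U$ on which (1) has a smooth positive solution. Moreover (1) has a smooth positive solution on every open $V\subset U$ for which there are an open set $O\subset\mathbb R^4\times\mathbb C$ and a smooth real function $Z(x,s)$ on $O$ that solves the pair of equations for each fixed $x$ and for which $(x,s)\mapsto(Z,Z_s,Z_{s^*},Z_{ss^*},s,s^*)$ is a diffeomorphism of $O$ onto $V$. 2. Let $V\subset U$ be open and let $\Phi$ be a smooth nowhere vanishing real solution of (1) on $V$. Then, for the tetrad with conformal parameter $\Phi$, there is a torsion-free generalized Weyl connection on $V$; every such connection has $A_s=A_{s^*}=0$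 on $V$; and $\pounds_{e_s}g=\pounds_{e_{s^*}}g=0$ on $V$. 3. (Uniqueness.) For $V$ and $\Phi$ as in 2, a smooth real function $\Psi$ on $V$ solves (1) if and only if $\Psi=\varpi\Phi$ for a real function $\varpi$ on the solution space of $V$. -/

import Mathlib

open scoped ContDiff ComplexConjugate

noncomputable section

namespace PairPDE

/-! ### The six-dimensional space and its complexified coordinate calculus

Points are `(Z, W, R, s)` with `Z`, `R` real and `W`, `s` complex; the remaining two coordinates
are the conjugates `W*` and `s*`.  Complex vector fields and complex-valued forms are given by
their components with respect to the complexified coordinate (co)frame belonging to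
`(Z, W, W*, R, s, s*)`, in this order, indexed by `Fin 6`. -/

/-- The space with coordinates `(Z, W, W*, R, s, s*)`. -/
abbrev Jet : Type := ℝ × ℂ × ℝ × ℂ

/-- The coordinate `W`. -/
def cW (p : Jet) : ℂ := p.2.1

/-- The coordinate `R`, as a complex number. -/
def cR (p : Jet) : ℂ := (p.2.2.1 : ℂ)

/-- The coordinate `s`. -/
def cs (p : Jet) : ℂ := p.2.2.2

/-- The partial derivatives of a complex function with respect to `Z, W, W*, R, s, s*`
(Wirtinger derivatives in the complex coordinates). -/
def pd (I : Fin 6) (H : Jet → ℂ) (p : Jet) : ℂ :=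
  ![fderiv ℝ H p (1, 0, 0, 0),
    (fderiv ℝ H p (0, 1, 0, 0) - Complex.I * fderiv ℝ H p (0, Complex.I, 0, 0)) / 2,
    (fderiv ℝ H p (0, 1, 0, 0) + Complex.I * fderiv ℝ H p (0, Complex.I, 0, 0)) / 2,
    fderiv ℝ H p (0, 0, 1, 0),
    (fderiv ℝ H p (0, 0, 0, 1) - Complex.I * fderiv ℝ H p (0, 0, 0, Complex.I)) / 2,
    (fderiv ℝ H p (0, 0, 0, 1) + Complex.I * fderiv ℝ H p (0, 0, 0, Complex.I)) / 2] I

/-- The complex conjugate `H*` of a function `H`. -/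
def cc (H : Jet → ℂ) : Jet → ℂ := fun p => conj (H p)

/-- Complex vector fields, `X = ∑ X^I ∂_I`. -/
abbrev CVec : Type := Jet → Fin 6 → ℂ

/-- Complex one-forms, `ω = ∑ ω_I dy^I`. -/
abbrev CForm : Type := Jet → Fin 6 → ℂ

/-- Complex covariant two-tensors, `t = ∑ t_{IJ} dy^I ⊗ dy^J`. -/
abbrev CTensor : Type := Jet → Fin 6 → Fin 6 → ℂ

/-- The derivative `X H` of a function along a vector field. -/
def act (X : CVec) (H : Jet → ℂ) (p : Jet) : ℂ := ∑ I, X p I * pd I H p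

/-- The value `ω(X)`. -/
def pair (w : CForm) (X : CVec) (p : Jet) : ℂ := ∑ I, w p I * X p I

/-- The value `t(X, Y)`. -/
def pairTwo (t : CTensor) (X Y : CVec) (p : Jet) : ℂ := ∑ I, ∑ J, t p I J * X p I * Y p J

/-- The exterior derivative of a one-form, `(dω)_{IJ} = ∂_I ω_J - ∂_J ω_I`. -/
def extd (w : CForm) : CTensor :=
  fun p I J => pd I (fun q => w q J) p - pd J (fun q => w q I) p

/-- The wedge product of two one-forms. -/
def wedge (w σ : CForm) : CTensor := fun p I J => w p I * σ p J - w p J * σ p I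

/-- The Lie derivative of a covariant two-tensor,
`(£_X t)_{IJ} = X^K ∂_K t_{IJ} + t_{KJ} ∂_I X^K + t_{IK} ∂_J X^K`. -/
def lie (X : CVec) (t : CTensor) : CTensor := fun p I J =>
  ∑ K, (X p K * pd K (fun q => t q I J) p
    + t p K J * pd I (fun q => X q K) p + t p I K * pd J (fun q => X q K) p)

/-! ### The pair of equations `Z_ss = S`, `Z_s*s* = S*` -/

/-- The function `T`, the solution of the linear system `T = D* S`, `T* = D S*`. -/
def fT (S : Jet → ℂ) (p : Jet) : ℂ :=
  ((pd 5 S p + conj (cW p) * pd 0 S p + cR p * pd 1 S p + cc S p * pd 2 S p)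
    + pd 3 S p * (pd 4 (cc S) p + cW p * pd 0 (cc S) p + S p * pd 1 (cc S) p
        + cR p * pd 2 (cc S) p))
    / (1 - pd 3 S p * pd 3 (cc S) p)

/-- The vector field `e_s = D = ∂_s + W ∂_Z + S ∂_W + R ∂_W* + T ∂_R`. -/
def eS (S : Jet → ℂ) : CVec := fun p => ![cW p, S p, cR p, fT S p, 1, 0]

/-- The vector field `e_s* = D* = ∂_s* + W* ∂_Z + R ∂_W + S* ∂_W* + T* ∂_R`. -/
def eSstar (S : Jet → ℂ) : CVec :=
  fun p => ![conj (cW p), cR p, cc S p, cc (fT S) p, 0, 1]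

/-- The standing assumptions on the right-hand side `S` on a region `U`: smoothness, the
integrability condition `D² S* = D*² S`, and the inequality `1 - S_R S*_R > 0`
(here `S*_R` is the conjugate of `S_R`, since `R` is real). -/
structure IsAdmissible (U : Set Jet) (S : Jet → ℂ) : Prop where
  smooth : ContDiffOn ℝ ∞ S U
  integrable : ∀ p ∈ U, act (eS S) (act (eS S) (cc S)) p = act (eSstar S) (act (eSstar S) S) p
  ineq : ∀ p ∈ U, 0 < 1 - ‖pd 3 S p‖ ^ 2

/-! ### Tetrads -/

/-- The tetrad parameters `(α, b, b*, a, a*, c)`; `α` and `c` are real and `b*`, `a*` are the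
conjugates of `b`, `a`. -/
structure TetradParams where
  α : Jet → ℝ
  b : Jet → ℂ
  a : Jet → ℂ
  c : Jet → ℝ

/-- The tetrad parameters are smooth and give four independent forms on `U`. -/
structure TetradParams.Regular (τ : TetradParams) (U : Set Jet) : Prop where
  smooth_α : ContDiffOn ℝ ∞ τ.α U
  smooth_b : ContDiffOn ℝ ∞ τ.b U
  smooth_a : ContDiffOn ℝ ∞ τ.a U
  smooth_c : ContDiffOn ℝ ∞ τ.c U
  α_ne : ∀ p ∈ U, τ.α p ≠ 0
  b_ne : ∀ p ∈ U, 1 - τ.b p * conj (τ.b p) ≠ 0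

/-- The Pfaffian forms `β^0, β^1, β^+, β^-`, indexed by `0, 1, 2, 3`. -/
def beta (S : Jet → ℂ) (i : Fin 4) : CForm := fun p =>
  ![![1, 0, 0, 0, -cW p, -conj (cW p)],
    ![0, 0, 0, 1, -fT S p, -cc (fT S) p],
    ![0, 1, 0, 0, -S p, -cR p],
    ![0, 0, 1, 0, -cR p, -cc S p]] i

/-- The tetrad `θ^0, θ^1, θ^+, θ^-`, indexed by `0, 1, 2, 3`, with conformal parameter `Φ`. -/
def tetrad (S : Jet → ℂ) (τ : TetradParams) (Φ : Jet → ℝ) (i : Fin 4) : CForm := fun p I =>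
  (Φ p : ℂ) *
  ![beta S 0 p I,
    beta S 1 p I + τ.a p * beta S 2 p I + conj (τ.a p) * beta S 3 p I + τ.c p * beta S 0 p I,
    τ.α p * (beta S 2 p I + τ.b p * beta S 3 p I),
    τ.α p * (beta S 3 p I + conj (τ.b p) * beta S 2 p I)] i

/-- The frame `e_0, e_1, e_+, e_-, e_s, e_s*`, indexed by `0, ..., 5`, dual to
`θ^0, θ^1, θ^+, θ^-, ds, ds*`. -/
def frame (S : Jet → ℂ) (τ : TetradParams) (Φ : Jet → ℝ) (J : Fin 6) : CVec := fun p =>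
  let n : ℂ := ((Φ p : ℂ))⁻¹ / (τ.α p * (1 - τ.b p * conj (τ.b p)))
  ![(((Φ p : ℂ))⁻¹) • ![1, 0, 0, -(τ.c p : ℂ), 0, 0],
    (((Φ p : ℂ))⁻¹) • ![0, 0, 0, 1, 0, 0],
    n • ![0, 1, -conj (τ.b p), -(τ.a p - conj (τ.a p) * conj (τ.b p)), 0, 0],
    n • ![0, -τ.b p, 1, -(conj (τ.a p) - τ.a p * τ.b p), 0, 0],
    eS S p,
    eSstar S p] J

/-- The six forms `θ^0, θ^1, θ^+, θ^-, ds, ds*`. -/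
def coframe (S : Jet → ℂ) (τ : TetradParams) (Φ : Jet → ℝ) (J : Fin 6) : CForm := fun p =>
  ![tetrad S τ Φ 0 p, tetrad S τ Φ 1 p, tetrad S τ Φ 2 p, tetrad S τ Φ 3 p,
    ![0, 0, 0, 0, 1, 0], ![0, 0, 0, 0, 0, 1]] J

/-- `frame` is the frame dual to `coframe`. -/
theorem coframe_frame (S : Jet → ℂ) (τ : TetradParams) (Φ : Jet → ℝ) (p : Jet)
    (hΦ : Φ p ≠ 0) (hα : τ.α p ≠ 0) (hb : 1 - τ.b p * conj (τ.b p) ≠ 0) (J K : Fin 6) :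
    pair (coframe S τ Φ J) (frame S τ Φ K) p = if J = K then 1 else 0 := by
  have h1 : (Φ p : ℂ) ≠ 0 := by exact_mod_cast hΦ
  have h2 : (τ.α p : ℂ) ≠ 0 := by exact_mod_cast hα
  have h3 : 1 - conj (τ.b p) * τ.b p ≠ 0 := by rwa [mul_comm]
  fin_cases J <;> fin_cases K <;>
    simp [pair, coframe, frame, tetrad, beta, eS, eSstar, Fin.sum_univ_succ] <;>
    (try field_simp) <;> (try ring)

/-- The coefficients `Δ^i_{JK}` of `dθ^i = ½ Δ^i_{JK} θ^J ∧ θ^K`, namely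
`Δ^i_{JK} = dθ^i(e_J, e_K)`. The hatted coefficients are those of `Φ = 1`. -/
def Delta (S : Jet → ℂ) (τ : TetradParams) (Φ : Jet → ℝ) (i : Fin 4) (J K : Fin 6) (p : Jet) : ℂ :=
  pairTwo (extd (tetrad S τ Φ i)) (frame S τ Φ J) (frame S τ Φ K) p

/-- The trace `Δ̂^k_{ks}` (for `f = 4`) or `Δ̂^k_{ks*}` (for `f = 5`). -/
def traceHat (S : Jet → ℂ) (τ : TetradParams) (f : Fin 6) (p : Jet) : ℂ :=
  ∑ k : Fin 4, Delta S τ (fun _ => 1) k (Fin.castLE (by decide) k) f p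

/-- The flat metric `η_{ij}` in the order `0, 1, +, -`; it is its own inverse. -/
def eta : Matrix (Fin 4) (Fin 4) ℂ := !![0, 1, 0, 0; 1, 0, 0, 0; 0, 0, 0, -1; 0, 0, -1, 0]

/-- The metric `g = η_{ij} θ^i ⊗ θ^j`. -/
def metric (θ : Fin 4 → CForm) : CTensor := fun p I J => ∑ i, ∑ j, eta i j * θ i p I * θ j p J

/-- `ω_{ij}` is a torsion-free generalized Weyl connection for the tetrad `θ` on `V`, with Weyl
one-form `A`: it satisfies `dθ^i + ω^i_k ∧ θ^k = 0`, where `ω^i_k = η^{ij} ω_{jk}`, and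
`ω_{(ij)} = η_{ij} A`. -/
structure IsTorsionFreeWeyl (V : Set Jet) (θ : Fin 4 → CForm) (w : Fin 4 → Fin 4 → CForm)
    (A : CForm) : Prop where
  torsion : ∀ p ∈ V, ∀ i I J,
    extd (θ i) p I J + ∑ j, ∑ k, eta i j * wedge (w j k) (θ k) p I J = 0
  weyl : ∀ p ∈ V, ∀ i j I, (w i j p I + w j i p I) / 2 = eta i j * A p I

/-- The two equations `DΦ = ¼ Δ̂^k_{ks} Φ` and `D*Φ = ¼ Δ̂^k_{ks*} Φ` on `V`. -/
def SolvesConformal (S : Jet → ℂ) (τ : TetradParams) (V : Set Jet) (Φ : Jet → ℝ) : Prop :=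
  ∀ p ∈ V, act (eS S) (fun q => (Φ q : ℂ)) p = 1 / 4 * traceHat S τ 4 p * (Φ p : ℂ) ∧
    act (eSstar S) (fun q => (Φ q : ℂ)) p = 1 / 4 * traceHat S τ 5 p * (Φ p : ℂ)

/-! ### Solutions and the solution space -/

/-- `∂f/∂s` for a function on the `s`-plane. -/
def dS (f : ℂ → ℂ) (s : ℂ) : ℂ := (fderiv ℝ f s 1 - Complex.I * fderiv ℝ f s Complex.I) / 2

/-- `∂f/∂s*` for a function on the `s`-plane. -/
def dSstar (f : ℂ → ℂ) (s : ℂ) : ℂ := (fderiv ℝ f s 1 + Complex.I * fderiv ℝ f s Complex.I) / 2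

/-- The point `(Z, Z_s, Z_ss*, s)` determined by a real function `Z` of `s`. -/
def lift (Z : ℂ → ℝ) (s : ℂ) : Jet :=
  (Z s, dS (fun z => (Z z : ℂ)) s, (dSstar (dS (fun z => (Z z : ℂ))) s).re, s)

/-- `Z` is a solution of the pair of equations on the open set `Ω`, and its lift stays in `V`.
As `Z` is real, the equation `Z_s*s* = S*` is the conjugate of `Z_ss = S`. -/
structure IsSolution (S : Jet → ℂ) (V : Set Jet) (Ω : Set ℂ) (Z : ℂ → ℝ) : Prop where
  isOpen : IsOpen Ω
  smooth : ContDiffOn ℝ ∞ Z Ω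
  mem : ∀ s ∈ Ω, lift Z s ∈ V
  eqn : ∀ s ∈ Ω, dS (dS (fun z => (Z z : ℂ))) s = S (lift Z s)

/-- `p` and `q` lie on the lift, inside `V`, of one solution with connected domain. -/
def OnCommonSolution (S : Jet → ℂ) (V : Set Jet) (p q : V) : Prop :=
  ∃ (Ω : Set ℂ) (Z : ℂ → ℝ), IsPreconnected Ω ∧ IsSolution S V Ω Z ∧
    (cs p ∈ Ω ∧ lift Z (cs p) = p) ∧ (cs q ∈ Ω ∧ lift Z (cs q) = q)

/-- The solution space of the region `V`: the quotient of `V` by the equivalence relation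
generated by lying on a common solution, so that its points are the (continued) solutions. -/
def SolutionSpace (S : Jet → ℂ) (V : Set Jet) : Type := Quot (OnCommonSolution S V)

/-- The solution through a point of `V`. -/
def toSolution (S : Jet → ℂ) (V : Set Jet) (p : V) : SolutionSpace S V := Quot.mk _ p

/-- `Z(x, s)`, for `(x, s)` in the open set `O`, is a smooth four-parameter family of solutions
and `(x, s) ↦ (Z, Z_s, Z_ss*, s)` is a diffeomorphism of `O` onto `V`, so that `(x, s, s*)` are
coordinates on `V`. -/
structure IsGeneralSolution (S : Jet → ℂ) (V : Set Jet) (O : Set ((Fin 4 → ℝ) × ℂ))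
    (Z : (Fin 4 → ℝ) × ℂ → ℝ) : Prop where
  isOpen : IsOpen O
  smooth : ContDiffOn ℝ ∞ Z O
  eqn : ∀ y ∈ O, dS (dS (fun z => (Z (y.1, z) : ℂ))) y.2 = S (lift (fun z => Z (y.1, z)) y.2)
  bijOn : Set.BijOn (fun y : (Fin 4 → ℝ) × ℂ => lift (fun z => Z (y.1, z)) y.2) O V
  smooth_inv : ∃ G : Jet → (Fin 4 → ℝ) × ℂ, ContDiffOn ℝ ∞ G V ∧
    ∀ y ∈ O, G (lift (fun z => Z (y.1, z)) y.2) = y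

end PairPDE

end

/-! The fields e_s and e_s* combine into real fields v e_s + v* e_s* depending linearly on v in ℂ
(`flowField`). The integrability condition says that D*T is real, and this makes these fields
commute (`IsAdmissible.flowField_comm`). Their integral surfaces are the lifts of solutions
(`IsSolution.hasFDerivAt_lift`, `isSolution_of_hasFDerivAt`), and the time-one map of the commuting
fields, smooth in initial point and v (`exists_commuting_flow`), yields one through every point.

Existence. Let N = α²(1 - bb*), and let X be e_s or e_s*. The trace of the structure coefficients is
-X(log |N|) - div X (`traceHat_eq`). If Γ is a local diffeomorphism sending every flow field to a
constant vector, its Jacobian J satisfies X(log |J|) = -div X (`fderiv_det_fderiv`). Hence Φ =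
|J/N|^(1/4) solves the two equations (`exists_solvesConformal`). Locally Γ is obtained by flowing
back to a slice of constant s; when there is a four-parameter general solution, Γ is the inverse of
its lift.

Connection. Rescaling the tetrad by Φ replaces the Weyl form A by A - d log Φ
(`IsTorsionFreeWeyl.conformal`), and for Φ = 1 the trace of the structure coefficients in the
direction X is 4 A(X) (`IsTorsionFreeWeyl.sum_extd_frame`). So the two equations for Φ express the
vanishing of A_s and A_s*. Cartan's formula gives £_X g = -2 A(X) g
(`IsTorsionFreeWeyl.lie_metric`), so the metric is then invariant.

Uniqueness. The equations are linear and first order, so Ψ solves them exactly when Ψ/Φ is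
annihilated by e_s and e_s*. This means that Ψ/Φ is constant along lifts of solutions, that is, it
descends to the solution space (`IsAdmissible.descends_iff`). -/

/-! ### Smoothness of superposition operators on spaces of continuous functions -/

section Superposition

variable {K : Type*} [TopologicalSpace K] [CompactSpace K]

/-- Pointwise evaluation `(A, y) ↦ (t ↦ A t (y t))` of continuous families of operators. -/
noncomputable def ContinuousMap.clmApplyL (K : Type*) [TopologicalSpace K] [CompactSpace K]
    (E F : Type*) [NormedAddCommGroup E] [NormedSpace ℝ E]
    [NormedAddCommGroup F] [NormedSpace ℝ F] :
    C(K, E →L[ℝ] F) →L[ℝ] C(K, E) →L[ℝ] C(K, F) :=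
  LinearMap.mkContinuous₂
    (LinearMap.mk₂ ℝ (fun (A : C(K, E →L[ℝ] F)) (y : C(K, E)) =>
        (⟨fun t => A t (y t), A.continuous.clm_apply y.continuous⟩ : C(K, F)))
      (by intros; ext; simp) (by intros; ext; simp) (by intros; ext; simp) (by intros; ext; simp))
    1 (by
      intro A y
      rw [ContinuousMap.norm_le _ (by positivity)]
      intro t
      calc ‖A t (y t)‖ ≤ ‖A t‖ * ‖y t‖ := (A t).le_opNorm _
        _ ≤ 1 * ‖A‖ * ‖y‖ := by
          rw [one_mul]
          gcongr
          · exact A.norm_coe_le_norm t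
          · exact y.norm_coe_le_norm t)

@[simp] theorem ContinuousMap.clmApplyL_apply {E F : Type*} [NormedAddCommGroup E]
    [NormedSpace ℝ E] [NormedAddCommGroup F] [NormedSpace ℝ F]
    (A : C(K, E →L[ℝ] F)) (y : C(K, E)) (t : K) :
    ContinuousMap.clmApplyL K E F A y t = A t (y t) := rfl

theorem ContinuousMap.norm_clmApplyL_apply_le {E F : Type*} [NormedAddCommGroup E]
    [NormedSpace ℝ E] [NormedAddCommGroup F] [NormedSpace ℝ F]
    (A : C(K, E →L[ℝ] F)) (y : C(K, E)) :
    ‖ContinuousMap.clmApplyL K E F A y‖ ≤ ‖A‖ * ‖y‖ := by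
  rw [ContinuousMap.norm_le _ (by positivity)]
  intro t
  calc ‖A t (y t)‖ ≤ ‖A t‖ * ‖y t‖ := (A t).le_opNorm _
    _ ≤ ‖A‖ * ‖y‖ := by
      gcongr
      · exact A.norm_coe_le_norm t
      · exact y.norm_coe_le_norm t

/-- The superposition operator `y ↦ f ∘ y` is differentiable if `f` is `C¹`. -/
theorem ContinuousMap.hasFDerivAt_comp {E F : Type*} [NormedAddCommGroup E] [NormedSpace ℝ E]
    [NormedAddCommGroup F] [NormedSpace ℝ F] (f : C(E, F)) (f' : C(E, E →L[ℝ] F))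
    (hf : ∀ x, HasFDerivAt f (f' x) x) (y : C(K, E)) :
    HasFDerivAt (fun y : C(K, E) => f.comp y) (ContinuousMap.clmApplyL K E F (f'.comp y)) y := by
  rw [hasFDerivAt_iff_isLittleO_nhds_zero, Asymptotics.isLittleO_iff]
  intro ε hε
  have hc : Filter.Tendsto (fun z : C(K, E) => f'.comp z) (nhds y) (nhds (f'.comp y)) :=
    (ContinuousMap.continuous_postcomp f').tendsto y
  obtain ⟨r, hr, hball⟩ :=
    (Metric.tendsto_nhds_nhds (α := C(K, E)) (β := C(K, E →L[ℝ] F))).1 hc ε hε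
  filter_upwards [Metric.ball_mem_nhds (0 : C(K, E)) hr] with d hd
  rw [ContinuousMap.norm_le _ (by positivity)]
  intro t
  have hd' : ‖d‖ < r := by simpa using hd
  -- Mean value inequality on the segment from y t to y t + d t. The bound on the variation of f' is
  -- uniform in t because composition with f' is continuous in the sup norm.
  have key : ‖f (y t + d t) - f (y t) - (f' (y t)) ((y t + d t) - y t)‖
      ≤ ε * ‖(y t + d t) - y t‖ := by
    refine (convex_segment (y t) (y t + d t)).norm_image_sub_le_of_norm_hasFDerivWithin_le'
      (f := f) (f' := fun x => f' x)
      (fun x _ => (hf x).hasFDerivWithinAt) ?_ (left_mem_segment ℝ _ _) (right_mem_segment ℝ _ _)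
    intro x hx
    rw [segment_eq_image'] at hx
    obtain ⟨τ, hτ, rfl⟩ := hx
    have h1 : dist (y + τ • d) y < r := by
      rw [dist_eq_norm, add_sub_cancel_left, norm_smul, Real.norm_eq_abs, abs_of_nonneg hτ.1]
      calc τ * ‖d‖ ≤ 1 * ‖d‖ := by gcongr; exact hτ.2
        _ < r := by simpa using hd'
    have h2 := (ContinuousMap.dist_apply_le_dist (f := f'.comp (y + τ • d)) (g := f'.comp y)
      t).trans (hball h1).le
    rw [dist_eq_norm] at h2
    simpa using h2
  calc _ = ‖f (y t + d t) - f (y t) - (f' (y t)) ((y t + d t) - y t)‖ := by simp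
    _ ≤ _ := key
    _ ≤ ε * ‖d‖ := by
      gcongr
      simpa using d.norm_coe_le_norm t

universe u

/-- Induction on n: the derivative at y is pointwise application of f' ∘ y, again a superposition
operator followed by a continuous linear map. The target F varies in the induction, since f' takes
values in E →L[ℝ] F; keeping E and F in one universe makes this possible. -/
theorem ContinuousMap.contDiff_comp_nat {E : Type u} [NormedAddCommGroup E] [NormedSpace ℝ E]
    (n : ℕ) : ∀ {F : Type u} [NormedAddCommGroup F] [NormedSpace ℝ F] (f : C(E, F)),
      ContDiff ℝ n f → ContDiff ℝ n (fun y : C(K, E) => f.comp y) := by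
  induction n with
  | zero =>
    intro F _ _ f _
    exact contDiff_zero.2 (ContinuousMap.continuous_postcomp f)
  | succ n ih =>
    intro F _ _ f hf
    rw [Nat.cast_succ] at hf ⊢
    have hf' := contDiff_succ_iff_fderiv.1 hf
    let f' : C(E, E →L[ℝ] F) := ⟨fderiv ℝ f, hf'.2.2.continuous⟩
    refine contDiff_succ_iff_hasFDerivAt.2
      ⟨fun y => ContinuousMap.clmApplyL K E F (f'.comp y), ?_, fun y =>
        ContinuousMap.hasFDerivAt_comp f f' (fun x => (hf'.1 x).hasFDerivAt) y⟩
    exact (ContinuousMap.clmApplyL K E F).contDiff.comp (ih f' hf'.2.2)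

/-- The superposition operator of a smooth function is smooth. -/
theorem ContinuousMap.contDiff_comp {E F : Type u} [NormedAddCommGroup E] [NormedSpace ℝ E]
    [NormedAddCommGroup F] [NormedSpace ℝ F] (f : C(E, F)) (hf : ContDiff ℝ ∞ f) :
    ContDiff ℝ ∞ (fun y : C(K, E) => f.comp y) :=
  contDiff_infty.2 fun n => ContinuousMap.contDiff_comp_nat n f (contDiff_infty.1 hf n)

end Superposition

/-! ### The primitive as a bounded operator on C([0,1], E) -/

section IntegralOperator

open unitInterval

/-- The operator `y ↦ (t ↦ ∫₀ᵗ y)` on continuous functions on the unit interval. -/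
noncomputable def ContinuousMap.primitive (E : Type*) [NormedAddCommGroup E] [NormedSpace ℝ E] :
    C(I, E) →L[ℝ] C(I, E) :=
  LinearMap.mkContinuous
    { toFun := fun y => ⟨fun t => ∫ τ in (0 : ℝ)..t, Set.IccExtend zero_le_one y τ,
        (intervalIntegral.continuous_primitive
          (fun _ _ => (y.continuous.Icc_extend').intervalIntegrable _ _) 0).comp
          continuous_subtype_val⟩
      map_add' := by
        intro y z
        ext t
        exact intervalIntegral.integral_add (y.continuous.Icc_extend'.intervalIntegrable _ _)
          (z.continuous.Icc_extend'.intervalIntegrable _ _)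
      map_smul' := by
        intro r y
        ext t
        exact intervalIntegral.integral_smul r _ }
    1 (by
      intro y
      rw [ContinuousMap.norm_le _ (by positivity)]
      intro t
      refine (intervalIntegral.norm_integral_le_of_norm_le_const (C := ‖y‖)
        fun τ _ => y.norm_coe_le_norm _).trans ?_
      rw [sub_zero, abs_of_nonneg t.2.1, one_mul]
      exact mul_le_of_le_one_right (norm_nonneg _) t.2.2)

theorem ContinuousMap.primitive_apply {E : Type*} [NormedAddCommGroup E] [NormedSpace ℝ E]
    (y : C(I, E)) (t : I) :
    ContinuousMap.primitive E y t = ∫ τ in (0 : ℝ)..t, Set.IccExtend zero_le_one y τ := rfl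

theorem ContinuousMap.norm_primitive_apply_le {E : Type*} [NormedAddCommGroup E]
    [NormedSpace ℝ E] (y : C(I, E)) : ‖ContinuousMap.primitive E y‖ ≤ ‖y‖ :=
  (LinearMap.mkContinuous_norm_le _ zero_le_one _ |> fun h =>
    (ContinuousMap.primitive E).le_of_opNorm_le h y).trans_eq (one_mul _)

/-- If `y` is the restriction of a function with derivative `z`, it differs from the primitive
of `z` by its initial value. -/
theorem ContinuousMap.eq_const_add_primitive {E : Type*} [NormedAddCommGroup E]
    [NormedSpace ℝ E] [CompleteSpace E] (y z : C(I, E)) (f : ℝ → E) (hf : ∀ t : I, f t = y t)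
    (hd : ∀ t : I, HasDerivWithinAt f (z t) (Set.Icc 0 1) t) :
    y = ContinuousMap.const I (y 0) + ContinuousMap.primitive E z := by
  ext t
  have h := intervalIntegral.integral_eq_sub_of_hasDerivAt_of_le (a := 0) (b := (t : ℝ)) t.2.1
    (f := f) (f' := Set.IccExtend zero_le_one z) ?_ ?_
    (z.continuous.Icc_extend'.intervalIntegrable _ _)
  · simp only [ContinuousMap.add_apply, ContinuousMap.const_apply, ContinuousMap.primitive_apply]
    rw [h, hf t, show f 0 = y 0 from hf 0]
    abel
  · intro τ hτ
    have hτ' : τ ∈ Set.Icc (0 : ℝ) 1 := ⟨hτ.1, hτ.2.trans t.2.2⟩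
    exact (hd ⟨τ, hτ'⟩).continuousWithinAt.mono (Set.Icc_subset_Icc_right t.2.2)
  · intro τ hτ
    have hτ' : τ ∈ Set.Icc (0 : ℝ) 1 := ⟨hτ.1.le, hτ.2.le.trans t.2.2⟩
    rw [Set.IccExtend_of_mem _ _ hτ']
    exact (hd ⟨τ, hτ'⟩).hasDerivAt (Icc_mem_nhds hτ.1 (hτ.2.trans_le t.2.2))

/-- A primitive extends to a function with the given derivative. -/
theorem ContinuousMap.hasDerivAt_primitive {E : Type*} [NormedAddCommGroup E]
    [NormedSpace ℝ E] [CompleteSpace E] (z : C(I, E)) (t : ℝ) :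
    HasDerivAt (fun t => ∫ τ in (0 : ℝ)..t, Set.IccExtend zero_le_one z τ)
      (Set.IccExtend zero_le_one z t) t :=
  intervalIntegral.integral_hasDerivAt_right (z.continuous.Icc_extend'.intervalIntegrable _ _)
    (z.continuous.Icc_extend'.stronglyMeasurableAtFilter _ _) z.continuous.Icc_extend'.continuousAt

end IntegralOperator

/-! ### Smooth flows of commuting vector fields, by the inverse function theorem -/

section CommutingFlow

set_option maxSynthPendingDepth 3

open unitInterval ContinuousMap

universe u

variable {E P : Type u} [NormedAddCommGroup E] [NormedSpace ℝ E] [CompleteSpace E]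
  [NormedAddCommGroup P] [NormedSpace ℝ P]

/-- Solutions of `y' = X(y) v`, `y(0) = q` on the unit interval depend smoothly on `(q, v)`
near `(p, 0)`. -/
theorem exists_smooth_integral_curves [CompleteSpace P] (X : C(E, P →L[ℝ] E))
    (X' : C(E, E →L[ℝ] P →L[ℝ] E)) (hX : ContDiff ℝ ∞ X) (p : E) (W : Set E) (hW : IsOpen W)
    (hp : p ∈ W) :
    ∃ N : Set (E × P), IsOpen N ∧ (p, 0) ∈ N ∧ ∃ y : E × P → C(I, E), ContDiffOn ℝ ∞ y N ∧
      ∀ π ∈ N, y π = const I π.1 + primitive E (clmApplyL I P E (X.comp (y π)) (const I π.2)) ∧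
        (∀ t, y π t ∈ W) ∧ ‖X'.comp (y π)‖ * ‖π.2‖ < 1 := by
  let cP : P →L[ℝ] C(I, P) := ContinuousLinearMap.const ℝ I
  let cE : E →L[ℝ] C(I, E) := ContinuousLinearMap.const ℝ I
  -- The zeros of the second component are the solutions of the integral equation with data (q, v).
  -- Keeping (q, v) as the first component turns the parametrized equation into a problem for the
  -- inverse function theorem.
  let Ξ : (E × P) × C(I, E) → (E × P) × C(I, E) := fun a =>
    (a.1, a.2 - cE a.1.1 - primitive E (clmApplyL I P E (X.comp a.2) (cP a.1.2)))
  have hN : ContDiff ℝ ∞ (fun y : C(I, E) => X.comp y) := contDiff_comp X hX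
  have hA : ContDiff ℝ ∞ (fun a : (E × P) × C(I, E) => clmApplyL I P E (X.comp a.2)) :=
    (clmApplyL I P E).contDiff.comp (hN.comp contDiff_snd)
  have hu : ContDiff ℝ ∞ (fun a : (E × P) × C(I, E) => cP a.1.2) :=
    cP.contDiff.comp (contDiff_snd.comp contDiff_fst)
  have hΞ : ContDiff ℝ ∞ Ξ := by
    refine contDiff_fst.prodMk ((contDiff_snd.sub ?_).sub ?_)
    · exact cE.contDiff.comp (contDiff_fst.comp contDiff_fst)
    · exact (primitive E).contDiff.comp (hA.clm_apply hu)
  let a₀ : (E × P) × C(I, E) := ((p, 0), const I p)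
  let D : (E × P) →L[ℝ] C(I, E) := -(cE.comp (ContinuousLinearMap.fst ℝ E P)) -
    (primitive E).comp ((clmApplyL I P E (X.comp (const I p))).comp
      (cP.comp (ContinuousLinearMap.snd ℝ E P)))
  -- At v = 0 the term containing the derivative of X vanishes, so the partial derivative in y is
  -- the identity and the full derivative is triangular, hence invertible.
  let Ξ' : ((E × P) × C(I, E)) ≃L[ℝ] ((E × P) × C(I, E)) :=
    (ContinuousLinearEquiv.refl ℝ (E × P)).skewProd (ContinuousLinearEquiv.refl ℝ C(I, E)) D
  have hΞ' : HasFDerivAt Ξ (Ξ' : ((E × P) × C(I, E)) →L[ℝ] ((E × P) × C(I, E))) a₀ := by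
    have h1 := (hA.differentiable (by simp)).differentiableAt (x := a₀) |>.hasFDerivAt
    have h2 : HasFDerivAt (fun a : (E × P) × C(I, E) => cP a.1.2)
        (cP.comp ((ContinuousLinearMap.snd ℝ E P).comp
          (ContinuousLinearMap.fst ℝ (E × P) C(I, E)))) a₀ :=
      (cP.comp ((ContinuousLinearMap.snd ℝ E P).comp
          (ContinuousLinearMap.fst ℝ (E × P) C(I, E)))).hasFDerivAt
    have h3 := (primitive E).hasFDerivAt.comp a₀ (h1.clm_apply h2)
    have h4 : HasFDerivAt (fun a : (E × P) × C(I, E) => cE a.1.1)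
        (cE.comp ((ContinuousLinearMap.fst ℝ E P).comp
          (ContinuousLinearMap.fst ℝ (E × P) C(I, E)))) a₀ :=
      (cE.comp ((ContinuousLinearMap.fst ℝ E P).comp
          (ContinuousLinearMap.fst ℝ (E × P) C(I, E)))).hasFDerivAt
    have h5 := (hasFDerivAt_fst (𝕜 := ℝ) (p := a₀)).prodMk
      (((hasFDerivAt_snd (𝕜 := ℝ) (p := a₀)).sub h4).sub h3)
    refine h5.congr_fderiv ?_
    apply ContinuousLinearMap.ext
    intro b
    refine Prod.ext ?_ ?_
    · simp [Ξ']
    · simp [Ξ', D, a₀, cP]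
      abel
  let φ := hΞ.contDiffAt.toOpenPartialHomeomorph Ξ hΞ' (by simp)
  -- Three open conditions: the derivative stays invertible, so that the local inverse is smooth
  -- away from the base point too; the curve stays in W; and the linearized integral operator has
  -- norm below 1.
  let Q : Set ((E × P) × C(I, E)) := {a | fderiv ℝ Ξ a ∈
      Set.range ((↑) : (((E × P) × C(I, E)) ≃L[ℝ] ((E × P) × C(I, E))) → _)} ∩
    ({a | Set.MapsTo a.2 Set.univ W} ∩ {a | ‖X'.comp a.2‖ * ‖a.1.2‖ < 1})
  have hQ : IsOpen Q := by
    refine IsOpen.inter ?_ (IsOpen.inter ?_ ?_)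
    · exact ContinuousLinearEquiv.isOpen.preimage (hΞ.continuous_fderiv (by simp))
    · exact (ContinuousMap.isOpen_setOfPred_mapsTo isCompact_univ hW).preimage continuous_snd
    · refine isOpen_lt ?_ continuous_const
      exact (((ContinuousMap.continuous_postcomp X').comp continuous_snd).norm).mul
        (continuous_snd.comp continuous_fst).norm
  have ha₀ : a₀ ∈ φ.source := hΞ.contDiffAt.mem_toOpenPartialHomeomorph_source hΞ' (by simp)
  have hφa : Ξ a₀ = ((p, 0), 0) := by
    refine Prod.ext rfl ?_
    simp [Ξ, a₀, cP, cE]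
    ext t
    simp
  have hφ0 : φ.symm ((p, 0), 0) = a₀ := by
    rw [← hφa]
    exact φ.left_inv ha₀
  refine ⟨(fun π : E × P => (π, (0 : C(I, E)))) ⁻¹' (φ.target ∩ φ.symm ⁻¹' Q), ?_, ?_,
    fun π => (φ.symm (π, 0)).2, ?_, ?_⟩
  · exact (φ.isOpen_inter_preimage_symm hQ).preimage (by fun_prop)
  · refine ⟨?_, ?_⟩
    · change ((p, 0), 0) ∈ φ.target
      rw [← hφa]
      exact φ.map_source ha₀
    · change φ.symm ((p, 0), 0) ∈ Q
      rw [hφ0]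
      refine ⟨⟨Ξ', hΞ'.fderiv.symm⟩, fun t _ => hp, ?_⟩
      simp [a₀]
  · intro π hπ
    obtain ⟨Ψ, hΨ⟩ := hπ.2.1
    have h := φ.contDiffAt_symm (n := ∞) hπ.1 (f₀' := Ψ)
      (by
        rw [hΨ]
        exact ((hΞ.differentiable (by simp)) _).hasFDerivAt) hΞ.contDiffAt
    have h' : ContDiffAt ℝ ∞ (fun π : E × P => φ.symm (π, 0)) π :=
      h.comp π (contDiffAt_id.prodMk contDiffAt_const)
    exact (contDiffAt_snd.comp π h').contDiffWithinAt
  · intro π hπ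
    have h : Ξ (φ.symm (π, 0)) = (π, 0) := φ.right_inv hπ.1
    have h1 : (φ.symm (π, 0)).1 = π := congrArg Prod.fst h
    have h2 := congrArg Prod.snd h
    simp only [Ξ, h1] at h2
    refine ⟨?_, fun t => hπ.2.2.1 (Set.mem_univ t), ?_⟩
    · rw [sub_sub, sub_eq_zero] at h2
      exact h2
    · have := hπ.2.2.2
      simp only [Set.mem_ofPred_eq, h1] at this
      exact this

/-- For commuting vector fields, the derivative of the time-one map along the fields. -/
theorem fderiv_integral_curves (X : C(E, P →L[ℝ] E)) (X' : C(E, E →L[ℝ] P →L[ℝ] E))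
    (hX : ∀ x, HasFDerivAt X (X' x) x) {N : Set (E × P)} (hN : IsOpen N)
    {W : Set E} (hcomm : ∀ q ∈ W, ∀ v w, X' q (X q v) w = X' q (X q w) v)
    (y : E × P → C(I, E)) (hy : DifferentiableOn ℝ y N)
    (hfix : ∀ π ∈ N, y π = const I π.1 +
      primitive E (clmApplyL I P E (X.comp (y π)) (const I π.2)))
    (hmem : ∀ π ∈ N, ∀ t, y π t ∈ W) (hlt : ∀ π ∈ N, ‖X'.comp (y π)‖ * ‖π.2‖ < 1)
    {π : E × P} (hπ : π ∈ N) (w : P) (ξ η : ℝ) (t : I) :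
    fderiv ℝ y π (ξ • X π.1 w, η • w) t = (ξ + η * t) • X (y π t) w := by
  let cP : P →L[ℝ] C(I, P) := ContinuousLinearMap.const ℝ I
  let cE : E →L[ℝ] C(I, E) := ContinuousLinearMap.const ℝ I
  set δ : E × P := (ξ • X π.1 w, η • w) with hδ
  set u : C(I, E) := fderiv ℝ y π δ with hu
  have hyπ : HasFDerivAt y (fderiv ℝ y π) π :=
    ((hy π hπ).differentiableAt (hN.mem_nhds hπ)).hasFDerivAt
  -- the linearized equation
  have hlin : u = const I δ.1 + primitive E
      (clmApplyL I P E (clmApplyL I E (P →L[ℝ] E) (X'.comp (y π)) u) (const I π.2)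
        + clmApplyL I P E (X.comp (y π)) (const I δ.2)) := by
    have h1 : HasFDerivAt (fun π => clmApplyL I P E (X.comp (y π)))
        ((clmApplyL I P E).comp ((clmApplyL I E (P →L[ℝ] E) (X'.comp (y π))).comp
          (fderiv ℝ y π))) π :=
      (clmApplyL I P E).hasFDerivAt.comp π
        ((hasFDerivAt_comp X X' hX (y π)).comp π hyπ)
    have h2 : HasFDerivAt (fun π : E × P => cP π.2)
        (cP.comp (ContinuousLinearMap.snd ℝ E P)) π :=
      (cP.comp (ContinuousLinearMap.snd ℝ E P)).hasFDerivAt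
    have h3 := (primitive E).hasFDerivAt.comp π (h1.clm_apply h2)
    have h4 : HasFDerivAt (fun π : E × P => cE π.1)
        (cE.comp (ContinuousLinearMap.fst ℝ E P)) π :=
      (cE.comp (ContinuousLinearMap.fst ℝ E P)).hasFDerivAt
    have h5 := h4.add h3
    have h6 : (fun π : E × P => cE π.1 +
        primitive E (clmApplyL I P E (X.comp (y π)) (cP π.2))) =ᶠ[nhds π] y := by
      filter_upwards [hN.mem_nhds hπ] with ρ hρ
      exact (hfix ρ hρ).symm
    have h7 := (h5.congr_of_eventuallyEq h6.symm).unique hyπ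
    have h8 := congrArg (fun A => A δ) h7
    simp only [← hu] at h8
    refine h8.symm.trans ?_
    simp only [_root_.add_apply, ContinuousLinearMap.comp_apply,
      ContinuousLinearMap.flip_apply, ContinuousLinearMap.coe_fst',
      ContinuousLinearMap.coe_snd', ← hu]
    rw [add_comm (clmApplyL I P E (X.comp (y π)) _)]
    rfl
  let z : C(I, E) := clmApplyL I P E (X.comp (y π)) (const I π.2)
  -- An extension of the curve to the whole line, so that ordinary derivatives exist at the
  -- endpoints of [0,1] as well.
  let ybar : ℝ → E := fun t => π.1 + ∫ τ in (0 : ℝ)..t, Set.IccExtend zero_le_one z τ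
  have hybar : ∀ t : I, ybar t = y π t := by
    intro t
    rw [hfix π hπ]
    rfl
  have hybar' : ∀ t : I, HasDerivAt ybar (X (y π t) π.2) t := by
    intro t
    have h := (hasDerivAt_primitive z t).const_add π.1
    rw [Set.IccExtend_of_mem _ _ t.2] at h
    exact h
  -- The explicit candidate for the variation. Its t-derivative is η X(y)w + (ξ + ηt) X'(y)(X(y)v)w,
  -- and commutation turns the last factor into X'(y)(X(y)w)v, which is what the linearized equation
  -- requires.
  let U : C(I, E) := ⟨fun t => (ξ + η * t) • X (y π t) w, by fun_prop⟩
  have hU : U = const I δ.1 + primitive E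
      (clmApplyL I P E (clmApplyL I E (P →L[ℝ] E) (X'.comp (y π)) U) (const I π.2)
        + clmApplyL I P E (X.comp (y π)) (const I δ.2)) := by
    have h0 : U 0 = δ.1 := by
      have : y π 0 = π.1 := by
        rw [hfix π hπ]
        simp [primitive_apply]
      simp [U, this, hδ]
    rw [← h0]
    refine eq_const_add_primitive U _ (fun t => (ξ + η * t) • X (ybar t) w) ?_ ?_
    · intro t
      simp only [hybar]
      rfl
    · intro t
      have h1 : HasDerivAt (fun t : ℝ => ξ + η * t) η t := by
        simpa using ((hasDerivAt_id (t : ℝ)).const_mul η).const_add ξ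
      have h2 : HasDerivAt (fun t => X (ybar t) w) (X' (y π t) (X (y π t) π.2) w) t := by
        have h := (hX (ybar t)).comp_hasDerivAt (t : ℝ) (hybar' t)
        rw [hybar t] at h
        simpa using h.clm_apply (hasDerivAt_const (t : ℝ) w)
      have h3 := (h1.smul h2).hasDerivWithinAt (s := Set.Icc 0 1)
      refine h3.congr_deriv ?_
      simp only [hybar, ContinuousMap.add_apply, clmApplyL_apply, ContinuousMap.comp_apply,
        ContinuousMap.const_apply, U, ContinuousMap.coe_mk, hδ, map_smul,
        _root_.smul_apply]
      rw [hcomm _ (hmem π hπ t)]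
  -- Both u and U solve the same affine linear equation. Their difference is fixed by a linear
  -- operator of norm less than 1, so it is zero.
  have hz : u - U = primitive E
      (clmApplyL I P E (clmApplyL I E (P →L[ℝ] E) (X'.comp (y π)) (u - U)) (const I π.2)) := by
    conv_lhs => rw [hlin, hU]
    simp only [map_add, map_sub, _root_.sub_apply]
    abel
  have hnorm : ‖u - U‖ ≤ ‖X'.comp (y π)‖ * ‖π.2‖ * ‖u - U‖ := by
    conv_lhs => rw [hz]
    refine (norm_primitive_apply_le _).trans ((norm_clmApplyL_apply_le _ _).trans ?_)
    calc _ ≤ (‖X'.comp (y π)‖ * ‖u - U‖) * ‖π.2‖ := by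
          gcongr
          · exact norm_clmApplyL_apply_le _ _
          · rw [ContinuousMap.norm_le _ (norm_nonneg _)]
            intro _
            exact le_rfl
      _ = _ := by ring
  have h0 : u - U = 0 := by
    by_contra hne
    have hpos : 0 < ‖u - U‖ := norm_pos_iff.2 hne
    nlinarith [hlt π hπ]
  rw [sub_eq_zero.1 h0]
  rfl

/-- The time-one map `F(q, v)` of commuting smooth vector fields `X(·) v`. -/
theorem exists_commuting_flow [CompleteSpace P] [FiniteDimensional ℝ E] (X : E → P →L[ℝ] E)
    {U : Set E} (hU : IsOpen U) (hX : ContDiffOn ℝ ∞ X U) {p : E} (hp : p ∈ U)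
    (hcomm : ∀ q ∈ U, ∀ v w, fderiv ℝ X q (X q v) w = fderiv ℝ X q (X q w) v) :
    ∃ N : Set (E × P), IsOpen N ∧ (p, 0) ∈ N ∧ ∃ F : E × P → E, ContDiffOn ℝ ∞ F N ∧
      (∀ π ∈ N, F π ∈ U) ∧ (∀ q, (q, 0) ∈ N → F (q, 0) = q) ∧
      ∀ π ∈ N, ∀ (w : P) (ξ η : ℝ),
        fderiv ℝ F π (ξ • X π.1 w, η • w) = (ξ + η) • X (F π) w := by
  obtain ⟨r, hr, hrU⟩ := Metric.isOpen_iff.1 hU p hp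
  -- The cutoff makes the field globally smooth, as the superposition operators require. It equals 1
  -- on the ball of radius r/3, where the curves will be confined, so neither the field nor the
  -- commutation relation changes there.
  let χ : ContDiffBump p := ⟨r / 3, r / 2, by positivity, by linarith⟩
  let Y : E → P →L[ℝ] E := fun x => χ x • X x
  have hY : ContDiff ℝ ∞ Y := by
    rw [contDiff_iff_contDiffAt]
    intro x
    by_cases hx : x ∈ U
    · exact χ.contDiffAt.smul (hX.contDiffAt (hU.mem_nhds hx))
    · have hx' : x ∉ tsupport χ := by
        rw [χ.tsupport_eq]
        intro h
        exact hx (hrU (Metric.closedBall_subset_ball (show r / 2 < r by linarith) h))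
      have h0 : Y =ᶠ[nhds x] fun _ => 0 := by
        filter_upwards [(isClosed_tsupport χ).isOpen_compl.mem_nhds hx'] with z hz
        simp [Y, image_eq_zero_of_notMem_tsupport hz]
      exact contDiffAt_const.congr_of_eventuallyEq h0
  have hYX : Set.EqOn Y X (Metric.ball p (r / 3)) := by
    intro x hx
    simp [Y, χ.one_of_mem_closedBall (Metric.ball_subset_closedBall hx)]
  have hYX' : ∀ x ∈ Metric.ball p (r / 3), fderiv ℝ Y x = fderiv ℝ X x := fun x hx =>
    (hYX.eventuallyEq_of_mem (Metric.isOpen_ball.mem_nhds hx)).fderiv_eq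
  have hWU : Metric.ball p (r / 3) ⊆ U :=
    (Metric.ball_subset_ball (by linarith)).trans hrU
  let Yc : C(E, P →L[ℝ] E) := ⟨Y, hY.continuous⟩
  let Y' : C(E, E →L[ℝ] P →L[ℝ] E) := ⟨fderiv ℝ Y, hY.continuous_fderiv (by simp)⟩
  obtain ⟨N, hN, hpN, y, hy, hall⟩ := exists_smooth_integral_curves Yc Y' hY p
    (Metric.ball p (r / 3)) Metric.isOpen_ball (Metric.mem_ball_self (by positivity))
  have hstart : ∀ π ∈ N, y π 0 = π.1 := by
    intro π hπ
    rw [(hall π hπ).1]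
    simp [primitive_apply]
  let ev : C(I, E) →L[ℝ] E := ContinuousMap.evalCLM ℝ (1 : I)
  refine ⟨N, hN, hpN, fun π => y π 1, ev.contDiff.comp_contDiffOn hy,
    fun π hπ => hWU ((hall π hπ).2.1 1), ?_, ?_⟩
  · intro q hq
    change y (q, 0) 1 = q
    rw [(hall _ hq).1]
    have : const I (0 : P) = 0 := rfl
    simp [this]
  · intro π hπ w ξ η
    have h := fderiv_integral_curves Yc Y'
      (fun x => ((hY.differentiable (by simp)) x).hasFDerivAt) hN
      (W := Metric.ball p (r / 3)) (fun q hq v w => by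
        change fderiv ℝ Y q (Y q v) w = fderiv ℝ Y q (Y q w) v
        rw [hYX' q hq, hYX hq]
        exact hcomm q (hWU hq) v w) y (hy.differentiableOn (by simp))
      (fun π hπ => (hall π hπ).1) (fun π hπ => (hall π hπ).2.1)
      (fun π hπ => (hall π hπ).2.2) hπ w ξ η 1
    have h1 : π.1 ∈ Metric.ball p (r / 3) := hstart π hπ ▸ (hall π hπ).2.1 0
    have h2 : fderiv ℝ (fun π => y π 1) π = ev.comp (fderiv ℝ y π) :=
      (ev.hasFDerivAt.comp π
        ((hy.differentiableOn (by simp)).differentiableAt (hN.mem_nhds hπ)).hasFDerivAt).fderiv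
    rw [h2, ← hYX h1, ← hYX ((hall π hπ).2.1 1)]
    rw [mul_comm, Set.Icc.coe_one, one_mul] at h
    exact h

end CommutingFlow

noncomputable section

namespace PairPDE

/-! ### Coordinate calculus -/

/-- This is dH in the complexified coordinates; it links Mathlib's real derivative to the Wirtinger
components used in the definitions. -/
theorem fderiv_apply_eq_pd (H : Jet → ℂ) (p h : Jet) :
    fderiv ℝ H p h = h.1 * pd 0 H p + h.2.1 * pd 1 H p + conj h.2.1 * pd 2 H p
      + h.2.2.1 * pd 3 H p + h.2.2.2 * pd 4 H p + conj h.2.2.2 * pd 5 H p := by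
  obtain ⟨z, w, r, s⟩ := h
  have e : ((z, w, r, s) : Jet) = z • (1, 0, 0, 0) + w.re • (0, 1, 0, 0)
      + w.im • (0, Complex.I, 0, 0) + r • (0, 0, 1, 0) + s.re • (0, 0, 0, 1)
      + s.im • (0, 0, 0, Complex.I) := by
    simp [Complex.re_add_im]
  rw [e]
  simp only [map_add, map_smul, Complex.real_smul]
  have hw : (w.re : ℂ) = (w + conj w) / 2 := by
    rw [Complex.add_conj]; simp
  have hw' : (w.im : ℂ) = -Complex.I * (w - conj w) / 2 := by
    rw [Complex.sub_conj]; push_cast; linear_combination (w.im : ℂ) * Complex.I_mul_I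
  have hs : (s.re : ℂ) = (s + conj s) / 2 := by
    rw [Complex.add_conj]; simp
  have hs' : (s.im : ℂ) = -Complex.I * (s - conj s) / 2 := by
    rw [Complex.sub_conj]; push_cast; linear_combination (s.im : ℂ) * Complex.I_mul_I
  simp [pd]
  rw [hw, hw', hs, hs']
  ring

/-- The index of the conjugate coordinate. -/
def conjIdx : Fin 6 → Fin 6 := ![0, 2, 1, 3, 5, 4]

theorem fderiv_cc (H : Jet → ℂ) (p h : Jet) : fderiv ℝ (cc H) p h = conj (fderiv ℝ H p h) := by
  have := Complex.conjCLE.comp_fderiv (f := H) (x := p)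
  have e : (Complex.conjCLE ∘ H) = cc H := by
    ext q
    simp [cc]
  rw [e] at this
  rw [this]
  simp

theorem pd_cc (I : Fin 6) (H : Jet → ℂ) (p : Jet) :
    pd I (cc H) p = conj (pd (conjIdx I) H p) := by
  fin_cases I <;> simp [pd, conjIdx, fderiv_cc, map_ofNat, sub_eq_add_neg]

theorem pd_congr {I : Fin 6} {H K : Jet → ℂ} {p : Jet} (h : H =ᶠ[nhds p] K) :
    pd I H p = pd I K p := by
  simp only [pd, h.fderiv_eq]

theorem pd_mul (I : Fin 6) {H K : Jet → ℂ} {p : Jet} (hH : DifferentiableAt ℝ H p)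
    (hK : DifferentiableAt ℝ K p) :
    pd I (fun q => H q * K q) p = H p * pd I K p + pd I H p * K p := by
  fin_cases I <;> simp [pd, fderiv_fun_mul hH hK] <;> ring

theorem pd_add (I : Fin 6) {H K : Jet → ℂ} {p : Jet} (hH : DifferentiableAt ℝ H p)
    (hK : DifferentiableAt ℝ K p) :
    pd I (fun q => H q + K q) p = pd I H p + pd I K p := by
  fin_cases I <;> simp [pd, fderiv_fun_add hH hK] <;> ring

theorem pd_const (I : Fin 6) (c : ℂ) (p : Jet) : pd I (fun _ => c) p = 0 := by
  fin_cases I <;> simp [pd]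

theorem pd_sum (I : Fin 6) {ι : Type*} (t : Finset ι) {H : ι → Jet → ℂ} {p : Jet}
    (hH : ∀ i ∈ t, DifferentiableAt ℝ (H i) p) :
    pd I (fun q => ∑ i ∈ t, H i q) p = ∑ i ∈ t, pd I (H i) p := by
  have h := fderiv_fun_sum hH
  fin_cases I <;>
    simp [pd, h, Finset.mul_sum, Finset.sum_div,
      ← Finset.sum_sub_distrib, ← Finset.sum_add_distrib]

theorem contDiff_cW : ContDiff ℝ ∞ cW := contDiff_fst.comp contDiff_snd

theorem contDiff_cR : ContDiff ℝ ∞ cR :=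
  Complex.ofRealCLM.contDiff.comp (contDiff_fst.comp (contDiff_snd.comp contDiff_snd))

theorem fderiv_cW (p h : Jet) : fderiv ℝ cW p h = h.2.1 :=
  congrArg (fun A => A h) ((ContinuousLinearMap.fst ℝ ℂ (ℝ × ℂ)).comp
    (ContinuousLinearMap.snd ℝ ℝ (ℂ × ℝ × ℂ))).fderiv

theorem fderiv_cR (p h : Jet) : fderiv ℝ cR p h = (h.2.2.1 : ℂ) :=
  congrArg (fun A => A h) (Complex.ofRealCLM.comp ((ContinuousLinearMap.fst ℝ ℝ ℂ).comp
    ((ContinuousLinearMap.snd ℝ ℂ (ℝ × ℂ)).comp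
      (ContinuousLinearMap.snd ℝ ℝ (ℂ × ℝ × ℂ))))).fderiv

theorem pd_cW (I : Fin 6) (p : Jet) : pd I cW p = if I = 1 then 1 else 0 := by
  fin_cases I <;> simp [pd, fderiv_cW]

theorem pd_cR (I : Fin 6) (p : Jet) : pd I cR p = if I = 3 then 1 else 0 := by
  fin_cases I <;> simp [pd, fderiv_cR]

theorem contDiffOn_fderiv_apply {U : Set Jet} (hU : IsOpen U) {H : Jet → ℂ}
    (hH : ContDiffOn ℝ ∞ H U) (h : Jet) : ContDiffOn ℝ ∞ (fun p => fderiv ℝ H p h) U :=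
  (hH.fderiv_of_isOpen hU (m := ∞) (by simp)).clm_apply contDiffOn_const

theorem contDiffOn_pd {U : Set Jet} (hU : IsOpen U) {H : Jet → ℂ} (hH : ContDiffOn ℝ ∞ H U)
    (I : Fin 6) : ContDiffOn ℝ ∞ (pd I H) U := by
  have h := contDiffOn_fderiv_apply hU hH
  have e : pd I H = fun p => ![fderiv ℝ H p (1, 0, 0, 0),
    (fderiv ℝ H p (0, 1, 0, 0) - Complex.I * fderiv ℝ H p (0, Complex.I, 0, 0)) / 2,
    (fderiv ℝ H p (0, 1, 0, 0) + Complex.I * fderiv ℝ H p (0, Complex.I, 0, 0)) / 2,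
    fderiv ℝ H p (0, 0, 1, 0),
    (fderiv ℝ H p (0, 0, 0, 1) - Complex.I * fderiv ℝ H p (0, 0, 0, Complex.I)) / 2,
    (fderiv ℝ H p (0, 0, 0, 1) + Complex.I * fderiv ℝ H p (0, 0, 0, Complex.I)) / 2] I := rfl
  rw [e]
  fin_cases I
  · exact h _
  · exact ((h _).sub (contDiffOn_const.mul (h _))).div_const _
  · exact ((h _).add (contDiffOn_const.mul (h _))).div_const _
  · exact h _
  · exact ((h _).sub (contDiffOn_const.mul (h _))).div_const _
  · exact ((h _).add (contDiffOn_const.mul (h _))).div_const _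

theorem contDiffOn_cc {U : Set Jet} {H : Jet → ℂ} (hH : ContDiffOn ℝ ∞ H U) :
    ContDiffOn ℝ ∞ (cc H) U :=
  Complex.conjCLE.contDiff.comp_contDiffOn hH

/-! ### The vector fields tangent to the lifts of solutions -/

/-- The real vector field `v e_s + v* e_s*`, as a linear function of `v`. -/
def flowField (S : Jet → ℂ) (p : Jet) : ℂ →L[ℝ] Jet :=
  ((2 : ℝ) • Complex.reCLM.comp (ContinuousLinearMap.mul ℝ ℂ (cW p))).prod
    ((ContinuousLinearMap.mul ℝ ℂ (S p) +
        (ContinuousLinearMap.mul ℝ ℂ (cR p)).comp (Complex.conjCLE : ℂ →L[ℝ] ℂ)).prod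
      (((2 : ℝ) • Complex.reCLM.comp (ContinuousLinearMap.mul ℝ ℂ (fT S p))).prod
        (ContinuousLinearMap.id ℝ ℂ)))

theorem flowField_apply (S : Jet → ℂ) (p : Jet) (v : ℂ) :
    flowField S p v = (2 * (cW p * v).re, S p * v + cR p * conj v, 2 * (fT S p * v).re, v) :=
  rfl

theorem two_re (z : ℂ) : ((2 * z.re : ℝ) : ℂ) = z + conj z := by
  rw [Complex.add_conj]

/-- Justifies reading `flowField` as v e_s + v* e_s*. Taking v = 1 and v = i recovers the two
complex fields, so real calculus along `flowField` suffices. -/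
theorem fderiv_flowField (S H : Jet → ℂ) (p : Jet) (v : ℂ) :
    fderiv ℝ H p (flowField S p v) = v * act (eS S) H p + conj v * act (eSstar S) H p := by
  rw [fderiv_apply_eq_pd, flowField_apply]
  simp only [two_re]
  simp [act, eS, eSstar, Fin.sum_univ_succ, cc, cR]
  ring

theorem act_eS_eq (S H : Jet → ℂ) (p : Jet) : act (eS S) H p =
    (fderiv ℝ H p (flowField S p 1) - Complex.I * fderiv ℝ H p (flowField S p Complex.I)) / 2 := by
  rw [fderiv_flowField, fderiv_flowField]
  simp
  ring_nf
  simp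
  ring

theorem act_eSstar_eq (S H : Jet → ℂ) (p : Jet) : act (eSstar S) H p =
    (fderiv ℝ H p (flowField S p 1) + Complex.I * fderiv ℝ H p (flowField S p Complex.I)) / 2 := by
  rw [fderiv_flowField, fderiv_flowField]
  simp
  ring_nf
  simp
  ring

theorem act_eS_cc (S H : Jet → ℂ) (p : Jet) :
    act (eS S) (cc H) p = conj (act (eSstar S) H p) := by
  rw [act_eS_eq, act_eSstar_eq]
  simp [fderiv_cc, sub_eq_add_neg, map_ofNat]

theorem act_congr {X : CVec} {H K : Jet → ℂ} {p : Jet} (h : H =ᶠ[nhds p] K) :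
    act X H p = act X K p := by
  simp only [act, pd_congr h]

theorem act_add (X : CVec) {H K : Jet → ℂ} {p : Jet} (hH : DifferentiableAt ℝ H p)
    (hK : DifferentiableAt ℝ K p) :
    act X (fun q => H q + K q) p = act X H p + act X K p := by
  simp only [act, pd_add _ hH hK, mul_add, Finset.sum_add_distrib]

theorem act_mul (X : CVec) {H K : Jet → ℂ} {p : Jet} (hH : DifferentiableAt ℝ H p)
    (hK : DifferentiableAt ℝ K p) :
    act X (fun q => H q * K q) p = H p * act X K p + act X H p * K p := by
  simp only [act, pd_mul _ hH hK, Finset.mul_sum, Finset.sum_mul, ← Finset.sum_add_distrib]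
  refine Finset.sum_congr rfl fun _ _ => ?_
  ring

namespace IsAdmissible

variable {U : Set Jet} {S : Jet → ℂ}

theorem one_sub_ne (hS : IsAdmissible U S) {p : Jet} (hp : p ∈ U) :
    1 - pd 3 S p * conj (pd 3 S p) ≠ 0 := by
  have h := hS.ineq p hp
  rw [Complex.mul_conj, Complex.normSq_eq_norm_sq]
  exact_mod_cast h.ne'

theorem contDiffOn_fT (hS : IsAdmissible U S) (hU : IsOpen U) : ContDiffOn ℝ ∞ (fT S) U := by
  have h := contDiffOn_pd hU hS.smooth
  have hc := contDiffOn_pd hU (contDiffOn_cc hS.smooth)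
  have hW : ContDiffOn ℝ ∞ cW U := contDiff_cW.contDiffOn
  have hWc : ContDiffOn ℝ ∞ (fun p => conj (cW p)) U := contDiffOn_cc hW
  have hR : ContDiffOn ℝ ∞ cR U := contDiff_cR.contDiffOn
  have hden : ContDiffOn ℝ ∞ (fun p => 1 - pd 3 S p * pd 3 (cc S) p) U :=
    contDiffOn_const.sub ((h 3).mul (hc 3))
  refine ContDiffOn.congr (ContDiffOn.mul ?_ (hden.inv ?_)) fun p _ => div_eq_mul_inv _ _
  · exact ((((h 5).add (hWc.mul (h 0))).add (hR.mul (h 1))).add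
      ((contDiffOn_cc hS.smooth).mul (h 2))).add ((h 3).mul
      ((((hc 4).add (hW.mul (hc 0))).add (hS.smooth.mul (hc 1))).add (hR.mul (hc 2))))
  · intro p hp
    rw [pd_cc]
    exact hS.one_sub_ne hp

/-- `T = D* S`. -/
theorem act_eSstar_S (hS : IsAdmissible U S) {p : Jet} (hp : p ∈ U) :
    act (eSstar S) S p = fT S p := by
  have h := hS.one_sub_ne hp
  have h' : 1 - conj (pd 3 S p) * pd 3 S p ≠ 0 := by rwa [mul_comm]
  simp only [fT, act, eSstar, cc, Fin.sum_univ_succ]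
  simp only [← cc.eq_def, pd_cc]
  simp [conjIdx, cR, cc]
  field_simp
  ring

/-- `T* = D S*`. -/
theorem act_eS_ccS (hS : IsAdmissible U S) {p : Jet} (hp : p ∈ U) :
    act (eS S) (cc S) p = cc (fT S) p := by
  rw [act_eS_cc, hS.act_eSstar_S hp]
  rfl

/-- Since T* = DS* and T = D*S, the integrability condition reads DT* = D*T, and DT* is the
conjugate of D*T. -/
theorem conj_act_eSstar_fT (hS : IsAdmissible U S) (hU : IsOpen U) {p : Jet} (hp : p ∈ U) :
    conj (act (eSstar S) (fT S) p) = act (eSstar S) (fT S) p := by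
  have h := hS.integrable p hp
  have h1 : act (eS S) (cc S) =ᶠ[nhds p] cc (fT S) := by
    filter_upwards [hU.mem_nhds hp] with q hq using hS.act_eS_ccS hq
  have h2 : act (eSstar S) S =ᶠ[nhds p] fT S := by
    filter_upwards [hU.mem_nhds hp] with q hq using hS.act_eSstar_S hq
  rw [act_congr h1, act_congr h2, act_eS_cc] at h
  exact h

theorem contDiffOn_flowField (hS : IsAdmissible U S) (hU : IsOpen U) :
    ContDiffOn ℝ ∞ (flowField S) U := by
  refine contDiffOn_clm_apply.2 fun v => ?_
  simp only [flowField_apply]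
  have hR : ContDiff ℝ ∞ (fun z : ℂ => z.re) := Complex.reCLM.contDiff
  refine ContDiffOn.prodMk ?_ (ContDiffOn.prodMk ?_ (ContDiffOn.prodMk ?_ contDiffOn_const))
  · exact contDiffOn_const.mul
      (hR.comp_contDiffOn (contDiff_cW.contDiffOn.mul contDiffOn_const))
  · exact (hS.smooth.mul contDiffOn_const).add (contDiff_cR.contDiffOn.mul contDiffOn_const)
  · exact contDiffOn_const.mul
      (hR.comp_contDiffOn ((hS.contDiffOn_fT hU).mul contDiffOn_const))

theorem fderiv_flowField_apply (hS : IsAdmissible U S) (hU : IsOpen U) {p : Jet} (hp : p ∈ U)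
    (w : ℂ) (h : Jet) : fderiv ℝ (flowField S) p h w =
      (2 * (h.2.1 * w).re, fderiv ℝ S p h * w + h.2.2.1 * conj w,
        2 * (fderiv ℝ (fT S) p h * w).re, 0) := by
  have hX := ((hS.contDiffOn_flowField hU).differentiableOn (by simp)).differentiableAt
    (hU.mem_nhds hp)
  have hSd := (hS.smooth.differentiableOn (by simp)).differentiableAt (hU.mem_nhds hp)
  have hTd := ((hS.contDiffOn_fT hU).differentiableOn (by simp)).differentiableAt
    (hU.mem_nhds hp)
  have hWd := contDiff_cW.contDiffAt.differentiableAt (x := p) (by simp)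
  have hRd := contDiff_cR.contDiffAt.differentiableAt (x := p) (by simp)
  have h1 : fderiv ℝ (fun q => flowField S q w) p h = fderiv ℝ (flowField S) p h w := by
    have := hX.hasFDerivAt.clm_apply (hasFDerivAt_const w p)
    rw [this.fderiv]
    simp
  rw [← h1]
  simp only [flowField_apply]
  have a1 := (Complex.reCLM.hasFDerivAt.comp p (hWd.hasFDerivAt.mul_const w)).const_mul 2
  have a2 := (hSd.hasFDerivAt.mul_const w).add (hRd.hasFDerivAt.mul_const (conj w))
  have a3 := (Complex.reCLM.hasFDerivAt.comp p (hTd.hasFDerivAt.mul_const w)).const_mul 2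
  have a4 := a1.prodMk (a2.prodMk (a3.prodMk (hasFDerivAt_const w p)))
  have a5 := a4.fderiv
  simp only [Function.comp_def, Complex.reCLM_apply] at a5
  refine (congrArg (fun A => A h) a5).trans ?_
  simp [fderiv_cW, fderiv_cR, mul_comm]

/-- Each component of the derivative must be symmetric in v and w. In the Z component this holds
because R is real, in the W component because D*S = T, and in the R component because D*T is real.
-/
theorem flowField_comm (hS : IsAdmissible U S) (hU : IsOpen U) {p : Jet} (hp : p ∈ U)
    (v w : ℂ) : fderiv ℝ (flowField S) p (flowField S p v) w =
      fderiv ℝ (flowField S) p (flowField S p w) v := by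
  rw [hS.fderiv_flowField_apply hU hp, hS.fderiv_flowField_apply hU hp]
  simp only [fderiv_flowField, hS.act_eSstar_S hp]
  refine Prod.ext ?_ (Prod.ext ?_ (Prod.ext ?_ rfl))
  · simp [flowField_apply, cR]
    ring
  · simp only [flowField_apply, two_re]
    simp
    ring
  · have h := hS.conj_act_eSstar_fT hU hp
    obtain ⟨r, hr⟩ := Complex.conj_eq_iff_real.1 h
    simp [hr]
    ring

end IsAdmissible

end PairPDE
end

noncomputable section

namespace PairPDE

/-! ### Torsion-free generalized Weyl connections -/

theorem pairTwo_wedge (w σ : CForm) (X Y : CVec) (p : Jet) :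
    pairTwo (wedge w σ) X Y p = pair w X p * pair σ Y p - pair w Y p * pair σ X p := by
  simp only [pairTwo, wedge, pair, Finset.sum_mul_sum]
  rw [Finset.sum_comm' (s := Finset.univ) (t := fun _ => Finset.univ) (t' := Finset.univ)
    (s' := fun _ => Finset.univ) (f := fun I J => w p I * Y p I * (σ p J * X p J)) (by simp)]
  simp only [← Finset.sum_sub_distrib]
  exact Finset.sum_congr rfl fun I _ => Finset.sum_congr rfl fun J _ => by ring

theorem pairTwo_congr {t t' : CTensor} (X Y : CVec) {p : Jet} (h : ∀ I J, t p I J = t' p I J) :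
    pairTwo t X Y p = pairTwo t' X Y p := by
  simp only [pairTwo, h]

theorem extd_congr {w σ : CForm} {p : Jet} (h : ∀ I, (fun q => w q I) =ᶠ[nhds p] fun q => σ q I)
    (I J : Fin 6) : extd w p I J = extd σ p I J := by
  simp only [extd, pd_congr (h _)]

theorem extd_mul {f : Jet → ℂ} {w : CForm} {p : Jet} (hf : DifferentiableAt ℝ f p)
    (hw : ∀ I, DifferentiableAt ℝ (fun q => w q I) p) (I J : Fin 6) :
    extd (fun q K => f q * w q K) p I J =
      f p * extd w p I J + (pd I f p * w p J - pd J f p * w p I) := by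
  simp only [extd, pd_mul _ hf (hw _)]
  ring

namespace IsTorsionFreeWeyl

variable {V : Set Jet} {θ : Fin 4 → CForm} {w : Fin 4 → Fin 4 → CForm} {A : CForm}

/-- The change of a torsion-free generalized Weyl connection under a rescaling of the tetrad. -/
theorem conformal (h : IsTorsionFreeWeyl V θ w A) (hV : IsOpen V)
    (hθ : ∀ p ∈ V, ∀ i I, DifferentiableAt ℝ (fun q => θ i q I) p) {f : Jet → ℂ}
    (hf : ∀ p ∈ V, DifferentiableAt ℝ f p) (hf0 : ∀ p ∈ V, f p ≠ 0) {θ' : Fin 4 → CForm}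
    (hθ' : ∀ p ∈ V, ∀ i I, θ' i p I = f p * θ i p I) :
    IsTorsionFreeWeyl V θ' (fun i j p I => w i j p I - eta i j * (pd I f p / f p))
      (fun p I => A p I - pd I f p / f p) where
  torsion p hp i I J := by
    have h1 := extd_congr (w := θ' i) (σ := fun q K => f q * θ i q K) (p := p)
      (fun K => by filter_upwards [hV.mem_nhds hp] with q hq using hθ' q hq i K) I J
    rw [h1, extd_mul (hf p hp) (hθ p hp i)]
    have h2 := h.torsion p hp i I J
    have h3 := hf0 p hp
    simp only [wedge, hθ' p hp] at h2 ⊢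
    fin_cases i <;> simp [Fin.sum_univ_four, eta] at h2 ⊢ <;> field_simp <;>
      linear_combination (f p) * h2
  weyl p hp i j I := by
    have h2 := h.weyl p hp i j I
    have h3 : eta j i = eta i j := by fin_cases i <;> fin_cases j <;> rfl
    simp only [h3]
    linear_combination h2

theorem extd_pairTwo (h : IsTorsionFreeWeyl V θ w A) {p : Jet} (hp : p ∈ V) (i : Fin 4)
    (X Y : CVec) : pairTwo (extd (θ i)) X Y p =
      ∑ j, ∑ k, eta i j * (pair (w j k) Y p * pair (θ k) X p
        - pair (w j k) X p * pair (θ k) Y p) := by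
  have h1 : pairTwo (extd (θ i)) X Y p =
      pairTwo (fun p I J => -∑ j, ∑ k, eta i j * wedge (w j k) (θ k) p I J) X Y p :=
    pairTwo_congr X Y fun I J => eq_neg_of_add_eq_zero_left (h.torsion p hp i I J)
  rw [h1]
  have h2 : ∀ j k, pair (w j k) Y p * pair (θ k) X p - pair (w j k) X p * pair (θ k) Y p =
      -pairTwo (wedge (w j k) (θ k)) X Y p := fun j k => by rw [pairTwo_wedge]; ring
  simp only [h2]
  fin_cases i <;> simp [Fin.sum_univ_four, eta, pairTwo, Finset.sum_add_distrib, add_mul]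

theorem pair_weyl (h : IsTorsionFreeWeyl V θ w A) {p : Jet} (hp : p ∈ V) (X : CVec)
    (i j : Fin 4) : pair (w i j) X p + pair (w j i) X p = 2 * eta i j * pair A X p := by
  simp only [pair, Finset.mul_sum, ← Finset.sum_add_distrib]
  refine Finset.sum_congr rfl fun I _ => ?_
  linear_combination 2 * X p I * h.weyl p hp i j I

/-- The trace of the structure coefficients is four times the Weyl one-form. -/
theorem sum_extd_frame (h : IsTorsionFreeWeyl V θ w A) {p : Jet} (hp : p ∈ V)
    (e : Fin 4 → CVec) (X : CVec) (he : ∀ i j, pair (θ i) (e j) p = if i = j then 1 else 0)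
    (hX : ∀ i, pair (θ i) X p = 0) :
    ∑ k, pairTwo (extd (θ k)) (e k) X p = 4 * pair A X p := by
  have h01 := h.pair_weyl hp X 0 1
  have h23 := h.pair_weyl hp X 2 3
  simp only [h.extd_pairTwo hp, he, hX]
  simp [Fin.sum_univ_four, eta] at h01 h23 ⊢
  linear_combination h01 - h23

/-- Along a field annihilated by the tetrad, the metric is rescaled by the Weyl one-form. -/
theorem lie_metric (h : IsTorsionFreeWeyl V θ w A) (hV : IsOpen V)
    (hθ : ∀ p ∈ V, ∀ i I, DifferentiableAt ℝ (fun q => θ i q I) p) {X : CVec}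
    (hX : ∀ p ∈ V, ∀ I, DifferentiableAt ℝ (fun q => X q I) p)
    (hθX : ∀ p ∈ V, ∀ i, pair (θ i) X p = 0) {p : Jet} (hp : p ∈ V) (I J : Fin 6) :
    lie X (metric θ) p I J = -2 * pair A X p * metric θ p I J := by
  -- Cartan's formula: since θ^i(X) = 0, £_X θ^i is the contraction of dθ^i with X, which the
  -- torsion equation evaluates as -ω^i_k(X) θ^k.
  have hL : ∀ i I, ∑ K, (X p K * pd K (fun q => θ i q I) p + θ i p K * pd I (fun q => X q K) p) =
      -∑ j, ∑ k, eta i j * (pair (w j k) X p * θ k p I) := by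
    intro i I
    have h0 : pd I (fun q => pair (θ i) X q) p = 0 := by
      rw [pd_congr (K := fun _ => 0), pd_const]
      filter_upwards [hV.mem_nhds hp] with q hq using hθX q hq i
    simp only [pair] at h0
    rw [pd_sum _ _ fun K _ => (hθ p hp i K).fun_mul (hX p hp K)] at h0
    simp only [pd_mul _ (hθ p hp i _) (hX p hp _)] at h0
    have h1 : ∑ K, (X p K * pd K (fun q => θ i q I) p + θ i p K * pd I (fun q => X q K) p) =
        ∑ K, X p K * extd (θ i) p K I := by
      rw [← sub_eq_zero, ← Finset.sum_sub_distrib, ← h0]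
      refine Finset.sum_congr rfl fun K _ => ?_
      simp only [extd]
      ring
    rw [h1]
    have h2 : ∀ K, extd (θ i) p K I = -∑ j, ∑ k, eta i j * wedge (w j k) (θ k) p K I :=
      fun K => eq_neg_of_add_eq_zero_left (h.torsion p hp i K I)
    have h3 : ∀ k, ∑ K, θ k p K * X p K = 0 := fun k => hθX p hp k
    have h4 : ∀ j k, ∑ K, X p K * wedge (w j k) (θ k) p K I = pair (w j k) X p * θ k p I := by
      intro j k
      have : ∀ K, X p K * wedge (w j k) (θ k) p K I =
          w j k p K * X p K * θ k p I - w j k p I * (θ k p K * X p K) := fun K => by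
        simp only [wedge]; ring
      simp only [this, Finset.sum_sub_distrib, ← Finset.mul_sum, h3, ← Finset.sum_mul, pair]
      ring
    simp only [h2, ← h4, Finset.mul_sum, mul_neg, Finset.sum_neg_distrib]
    rw [Finset.sum_comm]
    congr 1
    refine Finset.sum_congr rfl fun j _ => ?_
    rw [Finset.sum_comm]
    refine Finset.sum_congr rfl fun k _ => Finset.sum_congr rfl fun K _ => by ring
  have hm : ∀ K, pd K (fun q => metric θ q I J) p = ∑ i, ∑ j, eta i j *
      (pd K (fun q => θ i q I) p * θ j p J + θ i p I * pd K (fun q => θ j q J) p) := by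
    intro K
    have hd : ∀ i j, DifferentiableAt ℝ (fun q => eta i j * θ i q I * θ j q J) p := fun i j =>
      ((differentiableAt_const _).fun_mul (hθ p hp i I)).fun_mul (hθ p hp j J)
    simp only [metric]
    rw [pd_sum _ _ fun i _ => DifferentiableAt.fun_sum fun j _ => hd i j]
    refine Finset.sum_congr rfl fun i _ => ?_
    rw [pd_sum _ _ fun j _ => hd i j]
    refine Finset.sum_congr rfl fun j _ => ?_
    rw [pd_mul _ ((differentiableAt_const _).fun_mul (hθ p hp i I)) (hθ p hp j J),
      pd_mul _ (differentiableAt_const _) (hθ p hp i I), pd_const]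
    ring
  have key : lie X (metric θ) p I J = ∑ i, ∑ j, eta i j *
      ((∑ K, (X p K * pd K (fun q => θ i q I) p + θ i p K * pd I (fun q => X q K) p)) * θ j p J
        + θ i p I *
          ∑ K, (X p K * pd K (fun q => θ j q J) p + θ j p K * pd J (fun q => X q K) p)) := by
    simp only [lie, hm]
    simp only [metric, Finset.sum_mul, Finset.mul_sum, ← Finset.sum_add_distrib]
    rw [Finset.sum_comm]
    refine Finset.sum_congr rfl fun i _ => ?_
    rw [Finset.sum_comm]
    refine Finset.sum_congr rfl fun j _ => ?_
    refine Finset.sum_congr rfl fun K _ => ?_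
    ring
  rw [key]
  simp only [hL]
  -- Only the symmetric part of ω_{ij}(X) survives against θ^i ⊗ θ^j, and that part is η_{ij} A(X).
  have hs := h.pair_weyl hp X
  have h00 := hs 0 0
  have h01 := hs 0 1
  have h02 := hs 0 2
  have h03 := hs 0 3
  have h11 := hs 1 1
  have h12 := hs 1 2
  have h13 := hs 1 3
  have h22 := hs 2 2
  have h23 := hs 2 3
  have h33 := hs 3 3
  simp [eta] at h00 h01 h02 h03 h11 h12 h13 h22 h23 h33
  simp [Fin.sum_univ_four, metric, eta]
  rw [h00, h11, h22, h33, eq_neg_of_add_eq_zero_left h02, eq_neg_of_add_eq_zero_left h03,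
    eq_neg_of_add_eq_zero_left h12, eq_neg_of_add_eq_zero_left h13, eq_sub_of_add_eq h01,
    eq_sub_of_add_eq h23]
  ring

end IsTorsionFreeWeyl

/-! ### The tetrad -/

theorem tetrad_eq_mul (S : Jet → ℂ) (τ : TetradParams) (Φ : Jet → ℝ) (i : Fin 4) (p : Jet)
    (I : Fin 6) : tetrad S τ Φ i p I = (Φ p : ℂ) * tetrad S τ (fun _ => 1) i p I := by
  simp [tetrad]

theorem contDiffOn_ofReal {U : Set Jet} {f : Jet → ℝ} (hf : ContDiffOn ℝ ∞ f U) :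
    ContDiffOn ℝ ∞ (fun p => (f p : ℂ)) U :=
  Complex.ofRealCLM.contDiff.comp_contDiffOn hf

theorem IsAdmissible.contDiffOn_eS {U : Set Jet} {S : Jet → ℂ} (hS : IsAdmissible U S)
    (hU : IsOpen U) (I : Fin 6) : ContDiffOn ℝ ∞ (fun p => eS S p I) U := by
  fin_cases I
  · exact contDiff_cW.contDiffOn
  · exact hS.smooth
  · exact contDiff_cR.contDiffOn
  · exact hS.contDiffOn_fT hU
  · exact contDiffOn_const
  · exact contDiffOn_const

theorem IsAdmissible.contDiffOn_eSstar {U : Set Jet} {S : Jet → ℂ} (hS : IsAdmissible U S)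
    (hU : IsOpen U) (I : Fin 6) : ContDiffOn ℝ ∞ (fun p => eSstar S p I) U := by
  fin_cases I
  · exact contDiffOn_cc contDiff_cW.contDiffOn
  · exact contDiff_cR.contDiffOn
  · exact contDiffOn_cc hS.smooth
  · exact contDiffOn_cc (hS.contDiffOn_fT hU)
  · exact contDiffOn_const
  · exact contDiffOn_const

theorem IsAdmissible.contDiffOn_beta {U : Set Jet} {S : Jet → ℂ} (hS : IsAdmissible U S)
    (hU : IsOpen U) (i : Fin 4) (I : Fin 6) : ContDiffOn ℝ ∞ (fun p => beta S i p I) U := by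
  have hW : ContDiffOn ℝ ∞ cW U := contDiff_cW.contDiffOn
  have hR : ContDiffOn ℝ ∞ cR U := contDiff_cR.contDiffOn
  have hT := hS.contDiffOn_fT hU
  fin_cases i <;> fin_cases I <;> first
    | exact contDiffOn_const
    | exact hW.neg
    | exact (contDiffOn_cc hW).neg
    | exact hR.neg
    | exact hT.neg
    | exact (contDiffOn_cc hT).neg
    | exact hS.smooth.neg
    | exact (contDiffOn_cc hS.smooth).neg

theorem contDiffOn_tetrad {U : Set Jet} {S : Jet → ℂ} {τ : TetradParams} {Φ : Jet → ℝ}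
    (hS : IsAdmissible U S) (hU : IsOpen U) (hτ : τ.Regular U) (hΦ : ContDiffOn ℝ ∞ Φ U)
    (i : Fin 4) (I : Fin 6) : ContDiffOn ℝ ∞ (fun p => tetrad S τ Φ i p I) U := by
  have hβ := hS.contDiffOn_beta hU
  have hα := contDiffOn_ofReal hτ.smooth_α
  have hc := contDiffOn_ofReal hτ.smooth_c
  refine (contDiffOn_ofReal hΦ).mul ?_
  fin_cases i
  · exact hβ 0 I
  · exact (((hβ 1 I).add (hτ.smooth_a.mul (hβ 2 I))).add
      ((contDiffOn_cc hτ.smooth_a).mul (hβ 3 I))).add (hc.mul (hβ 0 I))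
  · exact hα.mul ((hβ 2 I).add (hτ.smooth_b.mul (hβ 3 I)))
  · exact hα.mul ((hβ 3 I).add ((contDiffOn_cc hτ.smooth_b).mul (hβ 2 I)))

theorem pair_tetrad_eS (S : Jet → ℂ) (τ : TetradParams) (Φ : Jet → ℝ) (i : Fin 4) (p : Jet) :
    pair (tetrad S τ Φ i) (eS S) p = 0 := by
  fin_cases i <;> simp [pair, tetrad, beta, eS, Fin.sum_univ_succ] <;> ring

theorem pair_tetrad_eSstar (S : Jet → ℂ) (τ : TetradParams) (Φ : Jet → ℝ) (i : Fin 4) (p : Jet) :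
    pair (tetrad S τ Φ i) (eSstar S) p = 0 := by
  fin_cases i <;> simp [pair, tetrad, beta, eSstar, Fin.sum_univ_succ] <;> ring

theorem pair_tetrad_frame (S : Jet → ℂ) (τ : TetradParams) (Φ : Jet → ℝ) {p : Jet}
    (hΦ : Φ p ≠ 0) (hα : τ.α p ≠ 0) (hb : 1 - τ.b p * conj (τ.b p) ≠ 0) (i j : Fin 4) :
    pair (tetrad S τ Φ i) (frame S τ Φ (Fin.castLE (by decide) j)) p = if i = j then 1 else 0 := by
  have h := coframe_frame S τ Φ p hΦ hα hb (Fin.castLE (by decide) i) (Fin.castLE (by decide) j)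
  simp only [Fin.castLE_inj] at h
  rw [← h]
  fin_cases i <;> rfl

/-- Identifies the coefficients of the equations for Φ with the components of the Weyl form of the
unit tetrad along e_s and e_s*. -/
theorem traceHat_eq_pair {V : Set Jet} {S : Jet → ℂ} {τ : TetradParams}
    {w : Fin 4 → Fin 4 → CForm} {A : CForm}
    (h : IsTorsionFreeWeyl V (tetrad S τ (fun _ => 1)) w A) {p : Jet} (hp : p ∈ V)
    (hα : τ.α p ≠ 0) (hb : 1 - τ.b p * conj (τ.b p) ≠ 0) :
    traceHat S τ 4 p = 4 * pair A (eS S) p ∧ traceHat S τ 5 p = 4 * pair A (eSstar S) p :=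
  ⟨h.sum_extd_frame hp (fun k => frame S τ (fun _ => 1) (Fin.castLE (by decide) k)) (eS S)
    (pair_tetrad_frame S τ _ one_ne_zero hα hb) (fun i => pair_tetrad_eS S τ _ i p),
  h.sum_extd_frame hp (fun k => frame S τ (fun _ => 1) (Fin.castLE (by decide) k)) (eSstar S)
    (pair_tetrad_frame S τ _ one_ne_zero hα hb) (fun i => pair_tetrad_eSstar S τ _ i p)⟩

/-! ### Weyl connections of tetrads rescaled by a conformal parameter -/

section ConformalParameter

variable {U V : Set Jet} {S : Jet → ℂ} {τ : TetradParams} {Φ : Jet → ℝ}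

theorem differentiableAt_tetrad (hS : IsAdmissible U S) (hU : IsOpen U) (hτ : τ.Regular U)
    (hV : IsOpen V) (hVU : V ⊆ U) (hΦ : ContDiffOn ℝ ∞ Φ V) {p : Jet} (hp : p ∈ V)
    (i : Fin 4) (I : Fin 6) : DifferentiableAt ℝ (fun q => tetrad S τ Φ i q I) p := by
  have h1 := (contDiffOn_tetrad hS hU hτ (Φ := fun _ => 1) contDiffOn_const i I).mono hVU
  have h2 := (contDiffOn_ofReal hΦ).mul h1
  have h3 : (fun q => tetrad S τ Φ i q I) =
      fun q => (Φ q : ℂ) * tetrad S τ (fun _ => 1) i q I := by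
    ext q
    exact tetrad_eq_mul S τ Φ i q I
  rw [h3]
  exact (h2.differentiableOn (by simp)).differentiableAt (hV.mem_nhds hp)

theorem differentiableAt_ofReal (hV : IsOpen V) (hΦ : ContDiffOn ℝ ∞ Φ V) {p : Jet}
    (hp : p ∈ V) : DifferentiableAt ℝ (fun q => (Φ q : ℂ)) p :=
  ((contDiffOn_ofReal hΦ).differentiableOn (by simp)).differentiableAt (hV.mem_nhds hp)

theorem exists_torsionFreeWeyl (hS : IsAdmissible U S) (hU : IsOpen U) (hτ : τ.Regular U)
    (hconn : ∃ (w : Fin 4 → Fin 4 → CForm) (A : CForm),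
      IsTorsionFreeWeyl U (tetrad S τ (fun _ => 1)) w A)
    (hV : IsOpen V) (hVU : V ⊆ U) (hΦ : ContDiffOn ℝ ∞ Φ V) (hΦ0 : ∀ q ∈ V, Φ q ≠ 0) :
    ∃ (w : Fin 4 → Fin 4 → CForm) (A : CForm), IsTorsionFreeWeyl V (tetrad S τ Φ) w A := by
  obtain ⟨w, A, h⟩ := hconn
  have h' : IsTorsionFreeWeyl V (tetrad S τ (fun _ => 1)) w A :=
    ⟨fun p hp => h.torsion p (hVU hp), fun p hp => h.weyl p (hVU hp)⟩
  exact ⟨_, _, h'.conformal hV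
    (fun p hp => differentiableAt_tetrad hS hU hτ hV hVU contDiffOn_const hp)
    (fun p hp => differentiableAt_ofReal hV hΦ hp) (fun p hp => by exact_mod_cast hΦ0 p hp)
    (fun p _ i I => tetrad_eq_mul S τ Φ i p I)⟩

theorem weyl_form_eq_zero (hS : IsAdmissible U S) (hU : IsOpen U) (hτ : τ.Regular U)
    (hV : IsOpen V) (hVU : V ⊆ U) (hΦ : ContDiffOn ℝ ∞ Φ V) (hΦ0 : ∀ q ∈ V, Φ q ≠ 0)
    (hsol : SolvesConformal S τ V Φ) {w : Fin 4 → Fin 4 → CForm} {A : CForm}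
    (h : IsTorsionFreeWeyl V (tetrad S τ Φ) w A) {q : Jet} (hq : q ∈ V) :
    pair A (eS S) q = 0 ∧ pair A (eSstar S) q = 0 := by
  have hd : ∀ p ∈ V, DifferentiableAt ℝ (fun q => (Φ q : ℂ)) p := fun p hp =>
    differentiableAt_ofReal hV hΦ hp
  have h0 : ∀ p ∈ V, (Φ p : ℂ) ≠ 0 := fun p hp => by exact_mod_cast hΦ0 p hp
  -- Rescaling by Φ⁻¹ leads back to the unit tetrad, with Weyl form A + d log Φ. Its components
  -- along e_s and e_s* are fixed by the trace, and the equations for Φ cancel the logarithmic term.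
  have h' := h.conformal hV
    (fun p hp => differentiableAt_tetrad hS hU hτ hV hVU hΦ hp)
    (f := fun q => ((Φ q : ℂ))⁻¹) (θ' := tetrad S τ (fun _ => 1))
    (fun p hp => (hd p hp).inv (h0 p hp)) (fun p hp => inv_ne_zero (h0 p hp))
    (fun p hp i I => by rw [tetrad_eq_mul S τ Φ, inv_mul_cancel_left₀ (h0 p hp)])
  have ht := traceHat_eq_pair h' hq (hτ.α_ne q (hVU hq)) (hτ.b_ne q (hVU hq))
  have hpd : ∀ I, pd I (fun q => ((Φ q : ℂ))⁻¹) q / ((Φ q : ℂ))⁻¹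
      = -(pd I (fun q => (Φ q : ℂ)) q / (Φ q : ℂ)) := by
    intro I
    have h1 : pd I (fun q => (Φ q : ℂ) * ((Φ q : ℂ))⁻¹) q = 0 := by
      rw [pd_congr (K := fun _ => 1), pd_const]
      filter_upwards [hV.mem_nhds hq] with p hp using mul_inv_cancel₀ (h0 p hp)
    rw [pd_mul I (hd q hq) ((hd q hq).fun_inv (h0 q hq))] at h1
    have h2 := h0 q hq
    field_simp at h1 ⊢
    linear_combination h1
  have hpair : ∀ X : CVec, pair (fun p I => A p I -
      pd I (fun q => ((Φ q : ℂ))⁻¹) p / ((Φ p : ℂ))⁻¹) X q =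
      pair A X q + act X (fun q => (Φ q : ℂ)) q / (Φ q : ℂ) := by
    intro X
    simp only [pair, hpd, act, Finset.sum_div, ← Finset.sum_add_distrib]
    exact Finset.sum_congr rfl fun I _ => by ring
  have hs := hsol q hq
  have h2 := h0 q hq
  rw [hpair, hpair] at ht
  rw [ht.1, ht.2] at hs
  constructor
  · have := hs.1
    field_simp at this
    simpa [hΦ0 q hq] using this
  · have := hs.2
    field_simp at this
    simpa [hΦ0 q hq] using this

theorem lie_metric_eq_zero (hS : IsAdmissible U S) (hU : IsOpen U) (hτ : τ.Regular U)
    (hconn : ∃ (w : Fin 4 → Fin 4 → CForm) (A : CForm),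
      IsTorsionFreeWeyl U (tetrad S τ (fun _ => 1)) w A)
    (hV : IsOpen V) (hVU : V ⊆ U) (hΦ : ContDiffOn ℝ ∞ Φ V) (hΦ0 : ∀ q ∈ V, Φ q ≠ 0)
    (hsol : SolvesConformal S τ V Φ) {q : Jet} (hq : q ∈ V) (I J : Fin 6) :
    lie (eS S) (metric (tetrad S τ Φ)) q I J = 0 ∧
      lie (eSstar S) (metric (tetrad S τ Φ)) q I J = 0 := by
  obtain ⟨w, A, h⟩ := exists_torsionFreeWeyl hS hU hτ hconn hV hVU hΦ hΦ0
  have hA := weyl_form_eq_zero hS hU hτ hV hVU hΦ hΦ0 hsol h hq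
  have hθ : ∀ p ∈ V, ∀ i I, DifferentiableAt ℝ (fun q => tetrad S τ Φ i q I) p := fun p hp =>
    differentiableAt_tetrad hS hU hτ hV hVU hΦ hp
  constructor
  · rw [h.lie_metric hV hθ (fun p hp I => ((hS.contDiffOn_eS hU I).differentiableOn
      (by simp)).differentiableAt (hU.mem_nhds (hVU hp)))
      (fun p _ i => pair_tetrad_eS S τ Φ i p) hq, hA.1]
    ring
  · rw [h.lie_metric hV hθ (fun p hp I => ((hS.contDiffOn_eSstar hU I).differentiableOn
      (by simp)).differentiableAt (hU.mem_nhds (hVU hp)))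
      (fun p _ i => pair_tetrad_eSstar S τ Φ i p) hq, hA.2]
    ring

end ConformalParameter

end PairPDE
end

noncomputable section

namespace PairPDE

/-! ### Wirtinger derivatives on the `s`-plane -/

theorem fderiv_eq_dS (f : ℂ → ℂ) (s h : ℂ) :
    fderiv ℝ f s h = h * dS f s + conj h * dSstar f s := by
  have e : h = h.re • (1 : ℂ) + h.im • Complex.I := by
    simp [Complex.re_add_im]
  have hc : conj h = h.re - h.im * Complex.I := by
    apply Complex.ext <;> simp
  conv_lhs => rw [e]
  rw [map_add, map_smul, map_smul, hc]
  simp only [dS, dSstar, Complex.real_smul]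
  generalize fderiv ℝ f s 1 = x
  generalize fderiv ℝ f s Complex.I = y
  linear_combination (x - Complex.I * y) / 2 * Complex.re_add_im h
    + (h.im : ℂ) * y * Complex.I_mul_I

/-- Every real-linear map of ℂ has the form v ↦ x v + y v*, with unique x and y; the Wirtinger
derivatives are read off from this form after each use of the chain rule. -/
theorem dS_of_hasFDerivAt {f : ℂ → ℂ} {f' : ℂ →L[ℝ] ℂ} {s x y : ℂ} (hf : HasFDerivAt f f' s)
    (h : ∀ v, f' v = v * x + conj v * y) : dS f s = x ∧ dSstar f s = y := by
  simp only [dS, dSstar, hf.fderiv, h]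
  constructor
  · simp
    linear_combination ((y - x) / 2) * Complex.I_mul_I
  · simp
    linear_combination ((x - y) / 2) * Complex.I_mul_I

theorem fderiv_conj (f : ℂ → ℂ) (s h : ℂ) :
    fderiv ℝ (fun z => conj (f z)) s h = conj (fderiv ℝ f s h) := by
  have := Complex.conjCLE.comp_fderiv (f := f) (x := s)
  have e : (Complex.conjCLE ∘ f) = fun z => conj (f z) := by
    ext z
    simp
  rw [e] at this
  rw [this]
  simp

theorem dS_conj (f : ℂ → ℂ) (s : ℂ) : dS (fun z => conj (f z)) s = conj (dSstar f s) := by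
  simp [dS, dSstar, fderiv_conj, map_ofNat, sub_eq_add_neg]

theorem dSstar_conj (f : ℂ → ℂ) (s : ℂ) : dSstar (fun z => conj (f z)) s = conj (dS f s) := by
  simp [dS, dSstar, fderiv_conj, map_ofNat]

theorem dSstar_ofReal (f : ℂ → ℝ) (s : ℂ) :
    dSstar (fun z => (f z : ℂ)) s = conj (dS (fun z => (f z : ℂ)) s) := by
  simp [← dSstar_conj]

theorem dS_congr {f g : ℂ → ℂ} {s : ℂ} (h : f =ᶠ[nhds s] g) : dS f s = dS g s := by
  simp only [dS, h.fderiv_eq]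

theorem dSstar_congr {f g : ℂ → ℂ} {s : ℂ} (h : f =ᶠ[nhds s] g) : dSstar f s = dSstar g s := by
  simp only [dSstar, h.fderiv_eq]

theorem contDiffOn_dS {Ω : Set ℂ} (hΩ : IsOpen Ω) {f : ℂ → ℂ} (hf : ContDiffOn ℝ ∞ f Ω) :
    ContDiffOn ℝ ∞ (dS f) Ω := by
  have h := fun v : ℂ => (hf.fderiv_of_isOpen hΩ (m := ∞) (by simp)).clm_apply
    (contDiffOn_const (c := v))
  exact ((h 1).sub (contDiffOn_const.mul (h Complex.I))).div_const 2

theorem contDiffOn_dSstar {Ω : Set ℂ} (hΩ : IsOpen Ω) {f : ℂ → ℂ} (hf : ContDiffOn ℝ ∞ f Ω) :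
    ContDiffOn ℝ ∞ (dSstar f) Ω := by
  have h := fun v : ℂ => (hf.fderiv_of_isOpen hΩ (m := ∞) (by simp)).clm_apply
    (contDiffOn_const (c := v))
  exact ((h 1).add (contDiffOn_const.mul (h Complex.I))).div_const 2

/-- Symmetry of the second derivative. It makes Z_ss* real for real Z, and it relates Z_sss* to the
derivative of S along a lift. -/
theorem dSstar_dS_comm {f : ℂ → ℂ} {s : ℂ} (hf : ContDiffAt ℝ ∞ f s) :
    dSstar (dS f) s = dS (dSstar f) s := by
  have hsymm : IsSymmSndFDerivAt ℝ f s := hf.isSymmSndFDerivAt (by simpa using ENat.LEInfty.out)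
  have hd : DifferentiableAt ℝ (fderiv ℝ f) s :=
    (hf.fderiv_right (m := ∞) (by simp)).differentiableAt (by simp)
  have h1 : ∀ v, HasFDerivAt (fun z => fderiv ℝ f z v) ((fderiv ℝ (fderiv ℝ f) s).flip v) s := by
    intro v
    refine (hd.hasFDerivAt.clm_apply (hasFDerivAt_const v s)).congr_fderiv ?_
    ext w
    simp
  have h2 := (((h1 1).sub ((h1 Complex.I).const_mul Complex.I)).mul_const (2⁻¹ : ℂ)).fderiv
  have h3 := (((h1 1).add ((h1 Complex.I).const_mul Complex.I)).mul_const (2⁻¹ : ℂ)).fderiv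
  have e2 : dS f = fun z => (fderiv ℝ f z 1 - Complex.I * fderiv ℝ f z Complex.I) * 2⁻¹ := by
    ext z
    rw [dS, div_eq_mul_inv]
  have e3 : dSstar f = fun z => (fderiv ℝ f z 1 + Complex.I * fderiv ℝ f z Complex.I) * 2⁻¹ := by
    ext z
    rw [dSstar, div_eq_mul_inv]
  have h2' : fderiv ℝ (dS f) s = _ := (congrArg (fun g => fderiv ℝ g s) e2).trans h2
  have h3' : fderiv ℝ (dSstar f) s = _ := (congrArg (fun g => fderiv ℝ g s) e3).trans h3
  rw [dSstar, dS, h2', h3']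
  have h4 : fderiv ℝ (fderiv ℝ f) s 1 Complex.I = fderiv ℝ (fderiv ℝ f) s Complex.I 1 :=
    hsymm 1 Complex.I
  simp [h4]
  ring

/-! ### Lifts of solutions are the integral surfaces -/

theorem contDiffOn_lift {Ω : Set ℂ} (hΩ : IsOpen Ω) {Z : ℂ → ℝ} (hZ : ContDiffOn ℝ ∞ Z Ω) :
    ContDiffOn ℝ ∞ (lift Z) Ω := by
  have h0 : ContDiffOn ℝ ∞ (fun z => (Z z : ℂ)) Ω := Complex.ofRealCLM.contDiff.comp_contDiffOn hZ
  have h1 := contDiffOn_dS hΩ h0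
  exact hZ.prodMk (h1.prodMk
    ((Complex.reCLM.contDiff.comp_contDiffOn (contDiffOn_dSstar hΩ h1)).prodMk contDiffOn_id))

/-- Except for the R component, the derivative of the lift is read off from its definition, from Z
being real and from Z_ss = S. The R component requires ∂_s Z_ss* = T; both sides solve the linear
system that determines T, and |S_R| < 1 gives uniqueness. -/
theorem IsSolution.hasFDerivAt_lift {U V : Set Jet} {S : Jet → ℂ} (hS : IsAdmissible U S)
    (hU : IsOpen U) (hVU : V ⊆ U) {Ω : Set ℂ} {Z : ℂ → ℝ} (hZ : IsSolution S V Ω Z) {s : ℂ}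
    (hs : s ∈ Ω) : HasFDerivAt (lift Z) (flowField S (lift Z s)) s := by
  have hΩ := hZ.isOpen
  have h0 : ContDiffOn ℝ ∞ (fun z => (Z z : ℂ)) Ω :=
    Complex.ofRealCLM.contDiff.comp_contDiffOn hZ.smooth
  set P : ℂ → ℂ := dS (fun z => (Z z : ℂ)) with hP
  have h1 : ContDiffOn ℝ ∞ P Ω := contDiffOn_dS hΩ h0
  set Q : ℂ → ℂ := dSstar P with hQ
  have h2 : ContDiffOn ℝ ∞ Q Ω := contDiffOn_dSstar hΩ h1
  have hcd : ∀ {f : ℂ → ℂ}, ContDiffOn ℝ ∞ f Ω → ∀ z ∈ Ω, ContDiffAt ℝ ∞ f z :=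
    fun hf z hz => hf.contDiffAt (hΩ.mem_nhds hz)
  have hPc : dSstar (fun z => (Z z : ℂ)) = fun z => conj (P z) := by
    ext z
    exact dSstar_ofReal Z z
  have hQc : ∀ z ∈ Ω, conj (Q z) = Q z := by
    intro z hz
    have h := dSstar_dS_comm (hcd h0 z hz)
    rw [hPc, dS_conj] at h
    exact h.symm
  have hQre : ∀ z ∈ Ω, ((Q z).re : ℂ) = Q z := fun z hz => Complex.conj_eq_iff_re.1 (hQc z hz)
  set t := dS Q s with ht
  have hQs : dSstar Q s = conj t := by
    rw [ht, ← dSstar_conj]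
    exact dSstar_congr (by filter_upwards [hΩ.mem_nhds hs] with z hz using (hQc z hz).symm)
  have hdP : ∀ z ∈ Ω, dS P z = S (lift Z z) := hZ.eqn
  have hlin : HasFDerivAt (lift Z) (fderiv ℝ (lift Z) s) s :=
    (((contDiffOn_lift hΩ hZ.smooth).contDiffAt (hΩ.mem_nhds hs)).differentiableAt
      (by simp)).hasFDerivAt
  have hform : ∀ h, fderiv ℝ (lift Z) s h =
      (2 * (P s * h).re, S (lift Z s) * h + Q s * conj h, 2 * (t * h).re, h) := by
    intro h
    have d0 : HasFDerivAt Z (fderiv ℝ Z s) s :=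
      ((hZ.smooth.contDiffAt (hΩ.mem_nhds hs)).differentiableAt (by simp)).hasFDerivAt
    have d1 : HasFDerivAt P (fderiv ℝ P s) s :=
      ((hcd h1 s hs).differentiableAt (by simp)).hasFDerivAt
    have d2 : HasFDerivAt Q (fderiv ℝ Q s) s :=
      ((hcd h2 s hs).differentiableAt (by simp)).hasFDerivAt
    have d := (d0.prodMk (d1.prodMk ((Complex.reCLM.hasFDerivAt.comp s d2).prodMk
      (hasFDerivAt_id s)))).fderiv
    refine (congrArg (fun A => A h) d).trans ?_
    refine Prod.ext ?_ (Prod.ext ?_ (Prod.ext ?_ rfl))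
    · have e1 : fderiv ℝ (fun z => (Z z : ℂ)) s h = (fderiv ℝ Z s h : ℝ) :=
        congrArg (fun A => A h) (Complex.ofRealCLM.hasFDerivAt.comp s d0).fderiv
      rw [fderiv_eq_dS, hPc] at e1
      have e2 := two_re (P s * h)
      apply Complex.ofReal_injective
      change ((fderiv ℝ Z s h : ℝ) : ℂ) = _
      rw [e2, ← e1, map_mul, ← hP]
      ring
    · change fderiv ℝ P s h = _
      rw [fderiv_eq_dS, hdP s hs, ← hQ]
      ring
    · change (fderiv ℝ Q s h).re = _
      rw [fderiv_eq_dS, hQs, ← ht]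
      have e2 := two_re (t * h)
      apply Complex.ofReal_injective
      rw [e2, ← map_mul, mul_comm h t, Complex.add_conj]
      simp
  have hq := hVU (hZ.mem s hs)
  have hT : fT S (lift Z s) = t := by
    have hS' : HasFDerivAt S (fderiv ℝ S (lift Z s)) (lift Z s) :=
      ((hS.smooth.contDiffAt (hU.mem_nhds hq)).differentiableAt (by simp)).hasFDerivAt
    -- Interchanging derivatives gives t = ∂_s*(Z_ss) = ∂_s*(S along the lift). The chain rule then
    -- yields the equation T = D*S with t in place of T.
    have h3 : t = dSstar (fun z => S (lift Z z)) s := by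
      rw [ht, hQ, ← dSstar_dS_comm (hcd h1 s hs)]
      exact dSstar_congr (by filter_upwards [hΩ.mem_nhds hs] with z hz using hdP z hz)
    have h4 := (dS_of_hasFDerivAt (f := fun z => S (lift Z z))
      (x := P s * pd 0 S (lift Z s) + S (lift Z s) * pd 1 S (lift Z s)
        + Q s * pd 2 S (lift Z s) + t * pd 3 S (lift Z s) + pd 4 S (lift Z s))
      (y := conj (P s) * pd 0 S (lift Z s) + Q s * pd 1 S (lift Z s)
        + conj (S (lift Z s)) * pd 2 S (lift Z s) + conj t * pd 3 S (lift Z s)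
        + pd 5 S (lift Z s)) (hS'.comp s hlin) (fun v => by
        rw [ContinuousLinearMap.comp_apply, hform, fderiv_apply_eq_pd]
        simp only [two_re, map_add, map_mul, Complex.conj_conj, hQc s hs]
        ring)).2
    rw [← h3] at h4
    have h5 := hS.act_eSstar_S hq
    have hR : cR (lift Z s) = Q s := hQre s hs
    simp [act, eSstar, Fin.sum_univ_succ, cc, hR] at h5
    have h6 : cW (lift Z s) = P s := rfl
    rw [h6] at h5
    -- The difference d of the two solutions satisfies d = S_R d*. Taking norms forces d = 0,
    -- because |S_R| < 1.
    have h7 : fT S (lift Z s) - t = conj (fT S (lift Z s) - t) * pd 3 S (lift Z s) := by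
      rw [map_sub]
      linear_combination -h4 - h5
    have h8 := congrArg norm h7
    rw [norm_mul, Complex.norm_conj] at h8
    have h9 := hS.ineq _ hq
    have h10 : ‖fT S (lift Z s) - t‖ = 0 := by
      by_contra hne
      have h11 : ‖pd 3 S (lift Z s)‖ = 1 := mul_left_cancel₀ hne (by rw [← h8, mul_one])
      rw [h11] at h9
      norm_num at h9
    exact sub_eq_zero.1 (norm_eq_zero.1 h10)
  refine hlin.congr_fderiv ?_
  apply ContinuousLinearMap.ext
  intro h
  rw [hform, flowField_apply, hT]
  have hR : cR (lift Z s) = Q s := hQre s hs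
  rw [hR]
  rfl

/-- A surface tangent to the fields `v e_s + v* e_s*` is the lift of a solution. -/
theorem isSolution_of_hasFDerivAt {V : Set Jet} {S : Jet → ℂ} {Ω : Set ℂ} (hΩ : IsOpen Ω)
    {σ : ℂ → Jet} (hσ : ContDiffOn ℝ ∞ σ Ω) (hmem : ∀ s ∈ Ω, σ s ∈ V)
    (hd : ∀ s ∈ Ω, HasFDerivAt σ (flowField S (σ s)) s) (hcs : ∀ s ∈ Ω, cs (σ s) = s) :
    IsSolution S V Ω (fun s => (σ s).1) ∧ ∀ s ∈ Ω, lift (fun s => (σ s).1) s = σ s := by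
  have hW : ∀ s ∈ Ω, dS (fun z => ((σ z).1 : ℂ)) s = cW (σ s) := by
    intro s hs
    have h := Complex.ofRealCLM.hasFDerivAt.comp s
      ((ContinuousLinearMap.fst ℝ ℝ (ℂ × ℝ × ℂ)).hasFDerivAt.comp s (hd s hs))
    refine (dS_of_hasFDerivAt h (x := cW (σ s)) (y := conj (cW (σ s))) fun v => ?_).1
    change ((2 * (cW (σ s) * v).re : ℝ) : ℂ) = _
    rw [two_re, map_mul]
    ring
  have hWW : ∀ s ∈ Ω, dS (fun z => ((σ z).1 : ℂ)) =ᶠ[nhds s] fun z => cW (σ z) := by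
    intro s hs
    filter_upwards [hΩ.mem_nhds hs] with z hz using hW z hz
  have hSR : ∀ s ∈ Ω, dS (fun z => cW (σ z)) s = S (σ s) ∧
      dSstar (fun z => cW (σ z)) s = cR (σ s) := by
    intro s hs
    have h := (ContinuousLinearMap.fst ℝ ℂ (ℝ × ℂ)).hasFDerivAt.comp s
      ((ContinuousLinearMap.snd ℝ ℝ (ℂ × ℝ × ℂ)).hasFDerivAt.comp s (hd s hs))
    refine dS_of_hasFDerivAt h fun v => ?_
    change S (σ s) * v + cR (σ s) * conj v = _
    ring
  have hlift : ∀ s ∈ Ω, lift (fun s => (σ s).1) s = σ s := by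
    intro s hs
    refine Prod.ext rfl (Prod.ext (hW s hs) (Prod.ext ?_ (hcs s hs).symm))
    change (dSstar (dS fun z => ((σ z).1 : ℂ)) s).re = (σ s).2.2.1
    rw [dSstar_congr (hWW s hs), (hSR s hs).2]
    exact Complex.ofReal_re _
  refine ⟨⟨hΩ, contDiff_fst.comp_contDiffOn hσ, fun s hs => ?_, fun s hs => ?_⟩, hlift⟩
  · rw [hlift s hs]
    exact hmem s hs
  · rw [hlift s hs, dS_congr (hWW s hs), (hSR s hs).1]

/-- Through every point of an open region there passes the lift of a solution. -/
theorem IsAdmissible.exists_isSolution {U V : Set Jet} {S : Jet → ℂ} (hS : IsAdmissible U S)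
    (hU : IsOpen U) (hV : IsOpen V) (hVU : V ⊆ U) {q : Jet} (hq : q ∈ V) :
    ∃ (Ω : Set ℂ) (Z : ℂ → ℝ), IsPreconnected Ω ∧ IsSolution S V Ω Z ∧ cs q ∈ Ω ∧
      lift Z (cs q) = q := by
  obtain ⟨N, hN, hqN, F, hF, hFV, hF0, hFd⟩ := exists_commuting_flow (flowField S) hV
    ((hS.contDiffOn_flowField hU).mono hVU) hq
    (fun p hp v w => hS.flowField_comm hU (hVU hp) v w)
  -- The surface s ↦ F(q, s - s(q)) passes through q at s = s(q). The derivative formula of the flow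
  -- with ξ = 0 and η = 1 says that it is tangent to the fields.
  let j : ℂ → Jet × ℂ := fun s => (q, s - cs q)
  have hj : ContDiff ℝ ∞ j := contDiff_const.prodMk (contDiff_id.sub contDiff_const)
  have hj' : ∀ s, HasFDerivAt j (ContinuousLinearMap.inr ℝ Jet ℂ) s := fun s =>
    ((hasFDerivAt_const (𝕜 := ℝ) q s).prodMk ((hasFDerivAt_id (𝕜 := ℝ) s).sub_const
      (cs q))).congr_fderiv
      (by ext <;> simp)
  have hjq : j (cs q) = (q, 0) := by simp [j]
  obtain ⟨r, hr, hball⟩ := Metric.isOpen_iff.1 (hN.preimage hj.continuous) (cs q)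
    (by rw [Set.mem_preimage, hjq]; exact hqN)
  have hΩ : IsOpen (Metric.ball (cs q) r) := Metric.isOpen_ball
  have hc : cs q ∈ Metric.ball (cs q) r := Metric.mem_ball_self hr
  have hpre : IsPreconnected (Metric.ball (cs q) r) := (convex_ball _ _).isPreconnected
  have hσ : ContDiffOn ℝ ∞ (fun s => F (j s)) (Metric.ball (cs q) r) :=
    hF.comp hj.contDiffOn hball
  have hd : ∀ s ∈ Metric.ball (cs q) r,
      HasFDerivAt (fun s => F (j s)) (flowField S (F (j s))) s := by
    intro s hs
    have h1 := ((hF.contDiffAt (hN.mem_nhds (hball hs))).differentiableAt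
      (by simp)).hasFDerivAt.comp s (hj' s)
    refine h1.congr_fderiv ?_
    apply ContinuousLinearMap.ext
    intro w
    have h2 := hFd (j s) (hball hs) w 0 1
    simpa using h2
  -- The s component of the flow field is v itself, so the s coordinate of the surface differs from
  -- s by a constant on the ball, and this constant vanishes at the centre.
  have hcs : ∀ s ∈ Metric.ball (cs q) r, cs (F (j s)) = s := by
    have hd' : ∀ s ∈ Metric.ball (cs q) r,
        HasFDerivAt (fun s => cs (F (j s)) - s) (0 : ℂ →L[ℝ] ℂ) s := by
      intro s hs
      have h1 := (((ContinuousLinearMap.snd ℝ ℝ ℂ).comp ((ContinuousLinearMap.snd ℝ ℂ (ℝ × ℂ)).comp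
        (ContinuousLinearMap.snd ℝ ℝ (ℂ × ℝ × ℂ)))).hasFDerivAt.comp s (hd s hs)).sub
        (hasFDerivAt_id s)
      refine h1.congr_fderiv ?_
      apply ContinuousLinearMap.ext
      intro w
      simp [flowField_apply]
    intro s hs
    have h1 := hΩ.is_const_of_fderiv_eq_zero (𝕜 := ℝ) hpre
      (fun s hs => (hd' s hs).differentiableAt.differentiableWithinAt)
      (fun s hs => (hd' s hs).fderiv) hs hc
    simp only [hjq, hF0 q hqN, sub_self] at h1
    exact sub_eq_zero.1 h1
  obtain ⟨h1, h2⟩ := isSolution_of_hasFDerivAt hΩ hσ (fun s hs => hFV _ (hball hs)) hd hcs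
  refine ⟨_, _, hpre, h1, hc, ?_⟩
  rw [h2 _ hc, hjq, hF0 q hqN]

/-! ### Functions on the solution space -/

theorem act_eq_zero_iff (S H : Jet → ℂ) (p : Jet) :
    (act (eS S) H p = 0 ∧ act (eSstar S) H p = 0) ↔ ∀ v, fderiv ℝ H p (flowField S p v) = 0 := by
  constructor
  · rintro ⟨h1, h2⟩ v
    rw [fderiv_flowField, h1, h2]
    simp
  · intro h
    rw [act_eS_eq, act_eSstar_eq, h, h]
    simp

/-- A function is constant along the lifts of solutions if and only if it descends to the
solution space. -/
theorem IsAdmissible.descends_iff {U V : Set Jet} {S : Jet → ℂ} (hS : IsAdmissible U S)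
    (hU : IsOpen U) (hV : IsOpen V) (hVU : V ⊆ U) {ρ : Jet → ℝ} (hρ : ContDiffOn ℝ ∞ ρ V) :
    (∀ p ∈ V, ∀ v, fderiv ℝ ρ p (flowField S p v) = 0) ↔
      ∃ ϖ : SolutionSpace S V → ℝ, ∀ q : V, ρ q = ϖ (toSolution S V q) := by
  have hd : ∀ p ∈ V, HasFDerivAt ρ (fderiv ℝ ρ p) p := fun p hp =>
    ((hρ.contDiffAt (hV.mem_nhds hp)).differentiableAt (by simp)).hasFDerivAt
  constructor
  · intro h
    refine ⟨Quot.lift (fun q : V => ρ q) ?_, fun q => rfl⟩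
    rintro p q ⟨Ω, Z, hΩ, hZ, ⟨hp, hp'⟩, ⟨hq, hq'⟩⟩
    have hd' : ∀ s ∈ Ω, HasFDerivAt (fun s => ρ (lift Z s)) (0 : ℂ →L[ℝ] ℝ) s := by
      intro s hs
      refine ((hd _ (hZ.mem s hs)).comp s (hZ.hasFDerivAt_lift hS hU hVU hs)).congr_fderiv ?_
      apply ContinuousLinearMap.ext
      intro v
      exact h _ (hZ.mem s hs) v
    have h1 := hZ.isOpen.is_const_of_fderiv_eq_zero (𝕜 := ℝ) hΩ
      (fun s hs => (hd' s hs).differentiableAt.differentiableWithinAt)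
      (fun s hs => (hd' s hs).fderiv) hp hq
    simp only [hp', hq'] at h1
    exact h1
  · rintro ⟨ϖ, hϖ⟩ p hp v
    -- Existence of a lift through p is what the converse needs: ρ is constant along it, and its
    -- tangent plane at p consists of all values of the flow field.
    obtain ⟨Ω, Z, hΩ, hZ, hpΩ, hpZ⟩ := hS.exists_isSolution hU hV hVU hp
    have h1 := (hd _ (hZ.mem _ hpΩ)).comp (cs p) (hZ.hasFDerivAt_lift hS hU hVU hpΩ)
    have h2 : (ρ ∘ lift Z) =ᶠ[nhds (cs p)] fun _ => ρ p := by
      filter_upwards [hZ.isOpen.mem_nhds hpΩ] with s hs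
      have h3 : OnCommonSolution S V ⟨lift Z s, hZ.mem s hs⟩ ⟨p, hp⟩ :=
        ⟨Ω, Z, hΩ, hZ, ⟨hs, rfl⟩, hpΩ, hpZ⟩
      change ρ (lift Z s) = ρ p
      rw [hϖ ⟨lift Z s, hZ.mem s hs⟩, hϖ ⟨p, hp⟩]
      exact congrArg ϖ (Quot.sound h3)
    have h4 := h1.unique ((hasFDerivAt_const (ρ p) (cs p)).congr_of_eventuallyEq h2)
    rw [hpZ] at h4
    exact congrArg (fun A => A v) h4

/-- By the product rule applied to Ψ = (Ψ/Φ) Φ, the equations for Ψ reduce to the vanishing of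
e_s(Ψ/Φ) and e_s*(Ψ/Φ). -/
theorem solvesConformal_iff_descends {U V : Set Jet} {S : Jet → ℂ} {τ : TetradParams}
    (hS : IsAdmissible U S) (hU : IsOpen U) (hV : IsOpen V) (hVU : V ⊆ U) {Φ Ψ : Jet → ℝ}
    (hΦ : ContDiffOn ℝ ∞ Φ V) (hΦ0 : ∀ q ∈ V, Φ q ≠ 0) (hsol : SolvesConformal S τ V Φ)
    (hΨ : ContDiffOn ℝ ∞ Ψ V) : SolvesConformal S τ V Ψ ↔
      ∃ ϖ : SolutionSpace S V → ℝ, ∀ q : V, Ψ q = ϖ (toSolution S V q) * Φ q := by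
  have hρ : ContDiffOn ℝ ∞ (fun q => Ψ q / Φ q) V := hΨ.div hΦ hΦ0
  have h0 : ∀ p ∈ V, (Φ p : ℂ) ≠ 0 := fun p hp => by exact_mod_cast hΦ0 p hp
  have h1 : (∃ ϖ : SolutionSpace S V → ℝ, ∀ q : V, Ψ q = ϖ (toSolution S V q) * Φ q) ↔
      ∃ ϖ : SolutionSpace S V → ℝ, ∀ q : V, Ψ q / Φ q = ϖ (toSolution S V q) :=
    exists_congr fun ϖ => forall_congr' fun q => (div_eq_iff (hΦ0 q q.2)).symm
  rw [h1, ← hS.descends_iff hU hV hVU hρ]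
  refine forall_congr' fun p => forall_congr' fun hp => ?_
  have hd : HasFDerivAt (fun q => Ψ q / Φ q) (fderiv ℝ (fun q => Ψ q / Φ q) p) p :=
    ((hρ.contDiffAt (hV.mem_nhds hp)).differentiableAt (by simp)).hasFDerivAt
  have h2 : ∀ v, fderiv ℝ (fun q => ((Ψ q / Φ q : ℝ) : ℂ)) p (flowField S p v) =
      (fderiv ℝ (fun q => Ψ q / Φ q) p (flowField S p v) : ℝ) := fun v =>
    congrArg (fun A => A (flowField S p v)) (Complex.ofRealCLM.hasFDerivAt.comp p hd).fderiv
  have h3 : (∀ v, fderiv ℝ (fun q => Ψ q / Φ q) p (flowField S p v) = 0) ↔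
      ∀ v, fderiv ℝ (fun q => ((Ψ q / Φ q : ℝ) : ℂ)) p (flowField S p v) = 0 :=
    forall_congr' fun v => by rw [h2]; exact Complex.ofReal_eq_zero.symm
  rw [h3, ← act_eq_zero_iff]
  have h4 : ∀ X : CVec, act X (fun q => (Ψ q : ℂ)) p =
      ((Ψ p / Φ p : ℝ) : ℂ) * act X (fun q => (Φ q : ℂ)) p
        + act X (fun q => ((Ψ q / Φ q : ℝ) : ℂ)) p * Φ p := by
    intro X
    rw [← act_mul X (differentiableAt_ofReal hV hρ hp) (differentiableAt_ofReal hV hΦ hp)]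
    refine act_congr ?_
    filter_upwards [hV.mem_nhds hp] with q hq
    have := h0 q hq
    push_cast
    field_simp
  rw [h4, h4, (hsol p hp).1, (hsol p hp).2]
  have h5 := h0 p hp
  have h6 : ((Ψ p / Φ p : ℝ) : ℂ) * Φ p = Ψ p := by
    push_cast
    field_simp
  have h7 : ∀ k x : ℂ, ((Ψ p / Φ p : ℝ) : ℂ) * (1 / 4 * k * Φ p) + x * Φ p = 1 / 4 * k * Ψ p ↔
      x = 0 := by
    intro k x
    rw [← h6]
    constructor
    · intro h
      have : x * Φ p = 0 := by linear_combination h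
      exact (mul_eq_zero.1 this).resolve_right h5
    · rintro rfl
      ring
  rw [h7, h7]

end PairPDE
end

/-! ### Jacobi's formula and the Jacobian of straightening coordinates -/

section Jacobi

variable {E : Type*} [NormedAddCommGroup E] [NormedSpace ℝ E] [FiniteDimensional ℝ E]

theorem ContinuousLinearMap.contDiff_det : ContDiff ℝ ∞ (fun A : E →L[ℝ] E => A.det) := by
  let b := Module.finBasis ℝ E
  have h : (fun A : E →L[ℝ] E => A.det) = fun A => ∑ σ : Equiv.Perm _,
      (Equiv.Perm.sign σ : ℤ) • ∏ i, b.equivFunL (A (b i)) (σ i) := by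
    ext A
    rw [ContinuousLinearMap.det, ← LinearMap.det_toMatrix b, Matrix.det_apply]
    refine Finset.sum_congr rfl fun σ _ => ?_
    simp only [LinearMap.toMatrix_apply]
    rfl
  rw [h]
  refine ContDiff.sum fun σ _ => ContDiff.const_smul _ (contDiff_prod fun i _ => ?_)
  exact ((((ContinuousLinearMap.proj (R := ℝ) (φ := fun _ => ℝ) (σ i)).comp
    (b.equivFunL : E →L[ℝ] _)).comp
      (ContinuousLinearMap.apply ℝ E (b i))) : (E →L[ℝ] E) →L[ℝ] ℝ).contDiff

/-- Jacobi's formula for the derivative of the determinant. -/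
theorem ContinuousLinearMap.fderiv_det_comp (A N : E →L[ℝ] E) :
    fderiv ℝ (fun A : E →L[ℝ] E => A.det) A (A.comp N) =
      A.det * LinearMap.trace ℝ E N := by
  let b := Module.finBasis ℝ E
  have h1 : HasDerivAt (fun t : ℝ => A + t • A.comp N) (A.comp N) 0 := by
    simpa using ((hasDerivAt_id (0 : ℝ)).smul_const (A.comp N)).const_add A
  have h2 : HasFDerivAt (fun A : E →L[ℝ] E => A.det)
      (fderiv ℝ (fun A : E →L[ℝ] E => A.det) A) (A + (0 : ℝ) • A.comp N) := by
    rw [zero_smul, add_zero]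
    exact (ContinuousLinearMap.contDiff_det.differentiable (by simp)).differentiableAt.hasFDerivAt
  have h3 := h2.comp_hasDerivAt (0 : ℝ) h1
  set M := LinearMap.toMatrix b b (N : E →ₗ[ℝ] E) with hM
  -- Factoring A + tAN as A(1 + tN) covers singular A too. The second factor has determinant 1 + t
  -- tr N + t² r(t) with a polynomial remainder r.
  have h4 : ((fun A : E →L[ℝ] E => A.det) ∘ fun t : ℝ => A + t • A.comp N) =
      fun t => A.det * (1 + M.trace * t +
        (Matrix.det (1 + (Polynomial.X : Polynomial ℝ) • M.map Polynomial.C)).divX.divX.eval t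
          * t ^ 2) := by
    ext t
    have e : ((A + t • A.comp N : E →L[ℝ] E) : E →ₗ[ℝ] E) =
        (A : E →ₗ[ℝ] E) ∘ₗ (LinearMap.id + t • (N : E →ₗ[ℝ] E)) := by
      ext x
      simp
    rw [← Matrix.det_one_add_smul]
    simp only [Function.comp_apply, ContinuousLinearMap.det]
    rw [e, LinearMap.det_comp, ← LinearMap.det_toMatrix b (LinearMap.id + _)]
    congr 2
    rw [map_add, map_smul, LinearMap.toMatrix_id]
  rw [h4] at h3
  have h5 : HasDerivAt (fun t : ℝ => A.det * (1 + M.trace * t +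
        (Matrix.det (1 + (Polynomial.X : Polynomial ℝ) • M.map Polynomial.C)).divX.divX.eval t
          * t ^ 2)) (A.det * M.trace) 0 := by
    have h6 := ((((hasDerivAt_id (0 : ℝ)).const_mul M.trace).const_add 1).add
      (((Matrix.det (1 + (Polynomial.X : Polynomial ℝ) •
        M.map Polynomial.C)).divX.divX.hasDerivAt 0).mul
          ((hasDerivAt_id (0 : ℝ)).pow 2))).const_mul A.det
    simpa using h6
  rw [h3.unique h5, hM, LinearMap.trace_eq_matrix_trace ℝ b]

/-- If `Γ` maps the vector field `X` to a constant one, the logarithmic derivative of its Jacobian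
along `X` is minus the divergence of `X`. -/
theorem fderiv_det_fderiv {Γ X : E → E} {V : Set E} (hV : IsOpen V) (hΓ : ContDiffOn ℝ ∞ Γ V)
    {c : E} (hc : ∀ q ∈ V, fderiv ℝ Γ q (X q) = c) {q : E} (hq : q ∈ V)
    (hX : DifferentiableAt ℝ X q) :
    fderiv ℝ (fun q => (fderiv ℝ Γ q).det) q (X q) =
      -((fderiv ℝ Γ q).det * LinearMap.trace ℝ E (fderiv ℝ X q)) := by
  have hΓq := hΓ.contDiffAt (hV.mem_nhds hq)
  have hd : DifferentiableAt ℝ (fderiv ℝ Γ) q :=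
    (hΓq.fderiv_right (m := ∞) (by simp)).differentiableAt (by simp)
  have hsymm : IsSymmSndFDerivAt ℝ Γ q := hΓq.isSymmSndFDerivAt (by simpa using ENat.LEInfty.out)
  have h1 := (hd.hasFDerivAt.clm_apply hX.hasFDerivAt).unique
    ((hasFDerivAt_const c q).congr_of_eventuallyEq (by
      filter_upwards [hV.mem_nhds hq] with p hp using hc p hp))
  -- Differentiating DΓ(X) = c gives D²Γ(h, X) + DΓ(DX h) = 0; symmetry of D²Γ turns this into a
  -- formula for the derivative of DΓ along X.
  have h2 : fderiv ℝ (fderiv ℝ Γ) q (X q) = -(fderiv ℝ Γ q).comp (fderiv ℝ X q) := by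
    apply ContinuousLinearMap.ext
    intro h
    have h3 := congrArg (fun A => A h) h1
    simp at h3
    rw [hsymm]
    rw [_root_.neg_apply, ContinuousLinearMap.comp_apply]
    exact eq_neg_of_add_eq_zero_right h3
  have h4 := ((ContinuousLinearMap.contDiff_det (E := E)).differentiable
    (by simp)).differentiableAt (x := fderiv ℝ Γ q) |>.hasFDerivAt.comp q hd.hasFDerivAt
  have h5 := congrArg (fun A => A (X q)) h4.fderiv
  refine h5.trans ?_
  rw [ContinuousLinearMap.comp_apply, h2, map_neg, ContinuousLinearMap.fderiv_det_comp]

end Jacobi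

noncomputable section

namespace PairPDE

/-! ### The trace of the structure coefficients -/

/-- Cartan's formula again: when w(X) = 0, dw(Y, X) = -(£_X w)(Y). The right-hand side needs the
derivatives of the coefficients of w only along X. -/
theorem pairTwo_extd {w : CForm} {X : CVec} (Y : CVec) {p : Jet}
    (hw : ∀ I, DifferentiableAt ℝ (fun q => w q I) p)
    (hX : ∀ I, DifferentiableAt ℝ (fun q => X q I) p)
    (h0 : (fun q => pair w X q) =ᶠ[nhds p] fun _ => 0) :
    pairTwo (extd w) Y X p = -∑ I, Y p I *
      (act X (fun q => w q I) p + ∑ K, w p K * pd I (fun q => X q K) p) := by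
  have h1 : ∀ I, ∑ K, w p K * pd I (fun q => X q K) p =
      -∑ K, X p K * pd I (fun q => w q K) p := by
    intro I
    have h2 := pd_congr (I := I) h0
    rw [pd_const] at h2
    simp only [pair] at h2
    rw [pd_sum _ _ fun K _ => (hw K).fun_mul (hX K)] at h2
    simp only [pd_mul _ (hw _) (hX _), Finset.sum_add_distrib] at h2
    rw [eq_neg_of_add_eq_zero_left h2]
    simp only [mul_comm]
  simp only [h1, pairTwo, act, extd, ← Finset.sum_neg_distrib, ← Finset.sum_add_distrib,
    Finset.mul_sum]
  exact Finset.sum_congr rfl fun I _ => Finset.sum_congr rfl fun J _ => by ring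

/-- The factor `α² (1 - b b*)`. -/
def TetradParams.density (τ : TetradParams) (p : Jet) : ℝ :=
  τ.α p ^ 2 * (1 - Complex.normSq (τ.b p))

theorem TetradParams.ofReal_density (τ : TetradParams) (p : Jet) :
    (τ.density p : ℂ) = τ.α p * τ.α p * (1 - τ.b p * conj (τ.b p)) := by
  rw [density, Complex.mul_conj]
  push_cast
  ring

theorem TetradParams.Regular.density_ne {τ : TetradParams} {U : Set Jet} (hτ : τ.Regular U)
    {p : Jet} (hp : p ∈ U) : τ.density p ≠ 0 := by
  have h : (τ.density p : ℂ) ≠ 0 := by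
    rw [τ.ofReal_density]
    have := hτ.α_ne p hp
    exact mul_ne_zero (mul_ne_zero (by exact_mod_cast this) (by exact_mod_cast this))
      (hτ.b_ne p hp)
  exact_mod_cast h

theorem TetradParams.Regular.contDiffOn_density {τ : TetradParams} {U : Set Jet}
    (hτ : τ.Regular U) : ContDiffOn ℝ ∞ τ.density U := by
  have h : ContDiff ℝ ∞ (fun z : ℂ => Complex.normSq z) := by
    simp only [Complex.normSq_eq_norm_sq]
    exact contDiff_norm_sq ℝ
  exact (hτ.smooth_α.pow 2).mul (contDiffOn_const.sub (h.comp_contDiffOn hτ.smooth_b))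

/-- The coframe completed by ds and ds* has determinant ±α²(1 - bb*) in the coordinate coframe, so
the trace is minus the logarithmic rate of change of its volume form along X: the derivative of the
log density plus the divergence. The last two components of X have vanishing derivatives at p and
contribute nothing. -/
theorem sum_extd_tetrad {U : Set Jet} {S : Jet → ℂ} {τ : TetradParams} (hS : IsAdmissible U S)
    (hU : IsOpen U) (hτ : τ.Regular U) {X : CVec} {p : Jet} (hp : p ∈ U)
    (hX : ∀ I, DifferentiableAt ℝ (fun q => X q I) p)
    (h0 : ∀ k q, pair (tetrad S τ (fun _ => 1) k) X q = 0)
    (h4 : ∀ I, pd I (fun q => X q 4) p = 0) (h5 : ∀ I, pd I (fun q => X q 5) p = 0) :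
    ∑ k : Fin 4, pairTwo (extd (tetrad S τ (fun _ => 1) k))
      (frame S τ (fun _ => 1) (Fin.castLE (by decide) k)) X p =
      -(act X (fun q => (τ.density q : ℂ)) p / (τ.density p : ℂ)) -
        (pd 0 (fun q => X q 0) p + pd 1 (fun q => X q 1) p + pd 2 (fun q => X q 2) p
          + pd 3 (fun q => X q 3) p) := by
  have hθ := fun k I => differentiableAt_tetrad hS hU hτ hU subset_rfl
    (Φ := fun _ => 1) contDiffOn_const hp k I
  have hα := differentiableAt_ofReal hU hτ.smooth_α hp
  have hb : DifferentiableAt ℝ τ.b p :=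
    (hτ.smooth_b.contDiffAt (hU.mem_nhds hp)).differentiableAt (by simp)
  have hbc : DifferentiableAt ℝ (fun q => conj (τ.b q)) p :=
    ((contDiffOn_cc hτ.smooth_b).contDiffAt (hU.mem_nhds hp)).differentiableAt (by simp)
  have hconst : ∀ c : ℂ, act X (fun _ => c) p = 0 := fun c => by simp [act, pd_const]
  have hden : act X (fun q => (τ.density q : ℂ)) p =
      2 * τ.α p * act X (fun q => (τ.α q : ℂ)) p * (1 - τ.b p * conj (τ.b p))
      - τ.α p * τ.α p * (act X τ.b p * conj (τ.b p)
        + τ.b p * act X (fun q => conj (τ.b q)) p) := by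
    have e : (fun q => (τ.density q : ℂ)) = fun q => (τ.α q * τ.α q : ℂ) *
        (1 + (-1) * (τ.b q * conj (τ.b q))) := by
      ext q
      rw [τ.ofReal_density]
      ring
    have hbb := hb.fun_mul hbc
    rw [e, act_mul X (hα.fun_mul hα)
        ((differentiableAt_const _).fun_add ((differentiableAt_const _).fun_mul hbb)),
      act_mul X hα hα,
      act_add X (differentiableAt_const _) ((differentiableAt_const _).fun_mul hbb),
      act_mul X (differentiableAt_const _) hbb, act_mul X hb hbc, hconst, hconst]
    ring
  have e1 := act_mul X hα hb
  have e2 := act_mul X hα hbc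
  have n1 : (τ.α p : ℂ) ≠ 0 := by exact_mod_cast hτ.α_ne p hp
  have n2 := hτ.b_ne p hp
  have hk : ∀ k : Fin 4, pairTwo (extd (tetrad S τ (fun _ => 1) k))
      (frame S τ (fun _ => 1) (Fin.castLE (by decide) k)) X p = _ := fun k =>
    pairTwo_extd _ (hθ k) hX (Filter.Eventually.of_forall (h0 k))
  simp only [hk]
  rw [hden, τ.ofReal_density]
  simp [Fin.sum_univ_succ, frame, tetrad, beta, h4, h5, hconst, e1, e2]
  field_simp
  ring

theorem traceHat_eq {U : Set Jet} {S : Jet → ℂ} {τ : TetradParams} (hS : IsAdmissible U S)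
    (hU : IsOpen U) (hτ : τ.Regular U) {p : Jet} (hp : p ∈ U) :
    traceHat S τ 4 p = -(act (eS S) (fun q => (τ.density q : ℂ)) p / (τ.density p : ℂ))
        - (pd 1 S p + pd 3 (fT S) p) ∧
      traceHat S τ 5 p = -(act (eSstar S) (fun q => (τ.density q : ℂ)) p / (τ.density p : ℂ))
        - conj (pd 1 S p + pd 3 (fT S) p) := by
  constructor
  · have h := sum_extd_tetrad hS hU hτ (X := eS S) hp
      (fun I => ((hS.contDiffOn_eS hU I).contDiffAt (hU.mem_nhds hp)).differentiableAt (by simp))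
      (fun k q => pair_tetrad_eS S τ _ k q) (fun I => pd_const I 1 p) (fun I => pd_const I 0 p)
    refine h.trans ?_
    have e0 : pd 0 (fun q => eS S q 0) p = 0 :=
      (pd_cW 0 p).trans (by simp)
    have e1 : pd 1 (fun q => eS S q 1) p = pd 1 S p := rfl
    have e2 : pd 2 (fun q => eS S q 2) p = 0 :=
      (pd_cR 2 p).trans (by simp)
    have e3 : pd 3 (fun q => eS S q 3) p = pd 3 (fT S) p := rfl
    rw [e0, e1, e2, e3]
    ring
  · have h := sum_extd_tetrad hS hU hτ (X := eSstar S) hp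
      (fun I => ((hS.contDiffOn_eSstar hU I).contDiffAt
        (hU.mem_nhds hp)).differentiableAt (by simp))
      (fun k q => pair_tetrad_eSstar S τ _ k q) (fun I => pd_const I 0 p)
      (fun I => pd_const I 1 p)
    refine h.trans ?_
    have e0 : pd 0 (fun q => eSstar S q 0) p = 0 := by
      refine (pd_cc 0 cW p).trans ?_
      simp [conjIdx, pd_cW]
    have e1 : pd 1 (fun q => eSstar S q 1) p = 0 :=
      (pd_cR 1 p).trans (by simp)
    have e2 : pd 2 (fun q => eSstar S q 2) p = conj (pd 1 S p) := pd_cc 2 S p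
    have e3 : pd 3 (fun q => eSstar S q 3) p = conj (pd 3 (fT S) p) := pd_cc 3 (fT S) p
    rw [e0, e1, e2, e3, map_add]
    ring

/-- The divergence of the real field `v e_s + v* e_s*`. -/
theorem IsAdmissible.trace_fderiv_flowField {U : Set Jet} {S : Jet → ℂ} (hS : IsAdmissible U S)
    (hU : IsOpen U) {p : Jet} (hp : p ∈ U) (v : ℂ) :
    LinearMap.trace ℝ Jet (fderiv ℝ (fun q => flowField S q v) p) =
      2 * ((pd 1 S p + pd 3 (fT S) p) * v).re := by
  have hX := ((hS.contDiffOn_flowField hU).contDiffAt (hU.mem_nhds hp)).differentiableAt (by simp)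
  have h1 : ∀ h, fderiv ℝ (fun q => flowField S q v) p h =
      fderiv ℝ (flowField S) p h v := by
    intro h
    rw [(hX.hasFDerivAt.clm_apply (hasFDerivAt_const v p)).fderiv]
    simp
  -- The real basis for Z, Re W, Im W, R, Re s, Im s. Only the W and R blocks contribute, giving 2
  -- Re(S_W v) and 2 Re(T_R v).
  let b := (Module.Basis.singleton Unit ℝ).prod
    (Complex.basisOneI.prod ((Module.Basis.singleton Unit ℝ).prod Complex.basisOneI))
  rw [LinearMap.trace_eq_matrix_trace ℝ b, Matrix.trace]
  simp [Matrix.diag, LinearMap.toMatrix_apply, b, h1, hS.fderiv_flowField_apply hU hp, pd]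
  have e : ∀ x : ℂ, ((0, x, 0) : ℝ × ℂ × ℝ × ℂ) = (0, x, 0, 0) := fun x => rfl
  simp only [e]
  ring

/-! ### Existence of the conformal parameter -/

/-- Coordinates in which the fields `v e_s + v* e_s*` are constant give a conformal parameter. -/
theorem exists_solvesConformal {U V : Set Jet} {S : Jet → ℂ} {τ : TetradParams}
    (hS : IsAdmissible U S) (hU : IsOpen U) (hτ : τ.Regular U) (hV : IsOpen V) (hVU : V ⊆ U)
    {Γ : Jet → Jet} (hΓ : ContDiffOn ℝ ∞ Γ V) (hdet : ∀ q ∈ V, (fderiv ℝ Γ q).det ≠ 0)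
    {c : ℂ → Jet} (hc : ∀ q ∈ V, ∀ v, fderiv ℝ Γ q (flowField S q v) = c v) :
    ∃ Φ : Jet → ℝ, ContDiffOn ℝ ∞ Φ V ∧ (∀ q ∈ V, 0 < Φ q) ∧ SolvesConformal S τ V Φ := by
  set J : Jet → ℝ := fun q => (fderiv ℝ Γ q).det with hJ
  have hJs : ContDiffOn ℝ ∞ J V :=
    ContinuousLinearMap.contDiff_det.comp_contDiffOn (hΓ.fderiv_of_isOpen hV (by simp))
  have hNs : ContDiffOn ℝ ∞ τ.density V := hτ.contDiffOn_density.mono hVU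
  have hN0 : ∀ q ∈ V, τ.density q ≠ 0 := fun q hq => hτ.density_ne (hVU hq)
  -- `Real.log` is the logarithm of the absolute value, so the exponential of φ is |J/N|^(1/4) and
  -- no sign condition on J or the density N is needed.
  let φ : Jet → ℝ := fun q => 1 / 4 * (Real.log (J q) - Real.log (τ.density q))
  have hφ : ContDiffOn ℝ ∞ φ V :=
    contDiffOn_const.mul ((hJs.log hdet).sub (hNs.log hN0))
  refine ⟨fun q => Real.exp (φ q), hφ.exp, fun q _ => Real.exp_pos _, fun p hp => ?_⟩
  have hd : ∀ {f : Jet → ℝ}, ContDiffOn ℝ ∞ f V → HasFDerivAt f (fderiv ℝ f p) p := fun hf =>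
    ((hf.contDiffAt (hV.mem_nhds hp)).differentiableAt (by simp)).hasFDerivAt
  have hX : ∀ v, DifferentiableAt ℝ (fun q => flowField S q v) p := fun v =>
    (((hS.contDiffOn_flowField hU).clm_apply contDiffOn_const).contDiffAt
      (hU.mem_nhds (hVU hp))).differentiableAt (by simp)
  have hJ' : ∀ v, fderiv ℝ J p (flowField S p v) =
      -(J p * (2 * ((pd 1 S p + pd 3 (fT S) p) * v).re)) := by
    intro v
    rw [← hS.trace_fderiv_flowField hU (hVU hp)]
    exact fderiv_det_fderiv (X := fun q => flowField S q v) hV hΓ (fun q hq => hc q hq v) hp (hX v)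
  have hN' : ∀ v, ((fderiv ℝ τ.density p (flowField S p v) : ℝ) : ℂ) =
      v * act (eS S) (fun q => (τ.density q : ℂ)) p
        + conj v * act (eSstar S) (fun q => (τ.density q : ℂ)) p := by
    intro v
    rw [← fderiv_flowField]
    exact (congrArg (fun A => A (flowField S p v))
      (Complex.ofRealCLM.hasFDerivAt.comp p (hd hNs)).fderiv).symm
  have hΦ' : ∀ v, fderiv ℝ (fun q => ((Real.exp (φ q) : ℝ) : ℂ)) p (flowField S p v) =
      v * (1 / 4 * traceHat S τ 4 p * (Real.exp (φ p) : ℂ))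
        + conj v * (1 / 4 * traceHat S τ 5 p * (Real.exp (φ p) : ℂ)) := by
    intro v
    have h1 := (((((hd hJs).log (hdet p hp)).sub
      ((hd hNs).log (hN0 p hp))).const_mul (1 / 4)).exp)
    have h2 := congrArg (fun A => A (flowField S p v))
      (Complex.ofRealCLM.hasFDerivAt.comp p h1).fderiv
    refine h2.trans ?_
    have h3 : ((2 * ((pd 1 S p + pd 3 (fT S) p) * v).re : ℝ) : ℂ) = _ := two_re _
    have hJp : (J p : ℂ) ≠ 0 := by exact_mod_cast hdet p hp
    have hNp : (τ.density p : ℂ) ≠ 0 := by exact_mod_cast hN0 p hp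
    change ((Real.exp (φ p) * (1 / 4 * ((J p)⁻¹ * fderiv ℝ J p (flowField S p v) -
      (τ.density p)⁻¹ * fderiv ℝ τ.density p (flowField S p v))) : ℝ) : ℂ) = _
    rw [hJ', (traceHat_eq hS hU hτ (hVU hp)).1, (traceHat_eq hS hU hτ (hVU hp)).2]
    rw [Complex.ofReal_mul, Complex.ofReal_mul, Complex.ofReal_sub, Complex.ofReal_mul,
      Complex.ofReal_mul, hN', Complex.ofReal_neg, Complex.ofReal_mul, h3]
    simp only [map_mul, map_add]
    push_cast
    field_simp
    ring
  rw [act_eS_eq, act_eSstar_eq, hΦ', hΦ']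
  simp only [map_one, Complex.conj_I]
  constructor
  · ring_nf
    simp
    ring
  · ring_nf
    simp
    ring

theorem finrank_parameters : Module.finrank ℝ ((Fin 4 → ℝ) × ℂ) = Module.finrank ℝ Jet := by
  simp [Module.finrank_prod, Complex.finrank_real_complex]

theorem contDiffOn_partial_dS {O : Set ((Fin 4 → ℝ) × ℂ)} (hO : IsOpen O)
    {H : (Fin 4 → ℝ) × ℂ → ℂ} (hH : ContDiffOn ℝ ∞ H O) :
    ContDiffOn ℝ ∞ (fun y => dS (fun z => H (y.1, z)) y.2) O ∧
      ContDiffOn ℝ ∞ (fun y => dSstar (fun z => H (y.1, z)) y.2) O := by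
  have h1 : ∀ y ∈ O, ∀ v, fderiv ℝ (fun z => H (y.1, z)) y.2 v = fderiv ℝ H y (0, v) := by
    intro y hy v
    have h2 : HasFDerivAt (fun z : ℂ => (y.1, z))
        (ContinuousLinearMap.inr ℝ (Fin 4 → ℝ) ℂ) y.2 := hasFDerivAt_prodMk_right y.1 y.2
    have h3 := (((hH.contDiffAt (hO.mem_nhds hy)).differentiableAt (by simp)).hasFDerivAt).comp
      y.2 h2
    exact congrArg (fun A => A v) h3.fderiv
  have h := fun v : ℂ => (hH.fderiv_of_isOpen hO (m := ∞) (by simp)).clm_apply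
    (contDiffOn_const (c := ((0, v) : (Fin 4 → ℝ) × ℂ)))
  refine ⟨(((h 1).sub ((contDiffOn_const (c := Complex.I)).mul (h Complex.I))).div_const 2).congr
      fun y hy => ?_,
    (((h 1).add ((contDiffOn_const (c := Complex.I)).mul (h Complex.I))).div_const 2).congr
      fun y hy => ?_⟩
  · simp only [dS, h1 y hy]
  · simp only [dSstar, h1 y hy]

theorem IsGeneralSolution.contDiffOn {S : Jet → ℂ} {V : Set Jet} {O : Set ((Fin 4 → ℝ) × ℂ)}
    {Z : (Fin 4 → ℝ) × ℂ → ℝ} (hZ : IsGeneralSolution S V O Z) :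
    ContDiffOn ℝ ∞ (fun y : (Fin 4 → ℝ) × ℂ => lift (fun z => Z (y.1, z)) y.2) O := by
  have h0 : ContDiffOn ℝ ∞ (fun y => (Z y : ℂ)) O :=
    Complex.ofRealCLM.contDiff.comp_contDiffOn hZ.smooth
  have h1 := (contDiffOn_partial_dS hZ.isOpen h0).1
  have h2 := (contDiffOn_partial_dS hZ.isOpen h1).2
  exact hZ.smooth.prodMk (h1.prodMk
    ((Complex.reCLM.contDiff.comp_contDiffOn h2).prodMk contDiffOn_snd))

theorem IsGeneralSolution.isSolution {S : Jet → ℂ} {V : Set Jet} {O : Set ((Fin 4 → ℝ) × ℂ)}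
    {Z : (Fin 4 → ℝ) × ℂ → ℝ} (hZ : IsGeneralSolution S V O Z) (x : Fin 4 → ℝ) :
    IsSolution S V {z | (x, z) ∈ O} (fun z => Z (x, z)) where
  isOpen := hZ.isOpen.preimage (by fun_prop)
  smooth := hZ.smooth.comp (contDiff_prodMk_right x).contDiffOn fun _ h => h
  mem s hs := hZ.bijOn.mapsTo hs
  eqn s hs := hZ.eqn (x, s) hs

/-- In the coordinates (x, s) the lifts are the surfaces x = const, so the flow field for v becomes
the constant vector (0, v). -/
theorem IsGeneralSolution.exists_solvesConformal {U V : Set Jet} {S : Jet → ℂ}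
    {τ : TetradParams} (hS : IsAdmissible U S) (hU : IsOpen U) (hτ : τ.Regular U)
    (hV : IsOpen V) (hVU : V ⊆ U) {O : Set ((Fin 4 → ℝ) × ℂ)} {Z : (Fin 4 → ℝ) × ℂ → ℝ}
    (hZ : IsGeneralSolution S V O Z) :
    ∃ Φ : Jet → ℝ, ContDiffOn ℝ ∞ Φ V ∧ (∀ q ∈ V, 0 < Φ q) ∧ SolvesConformal S τ V Φ := by
  obtain ⟨G, hG, hGF⟩ := hZ.smooth_inv
  -- Any linear isomorphism serves; it only turns the inverse chart into a self-map of the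
  -- six-dimensional space, for which a determinant is defined.
  let L : ((Fin 4 → ℝ) × ℂ) ≃L[ℝ] Jet := ContinuousLinearEquiv.ofFinrankEq finrank_parameters
  have hGd : ∀ q ∈ V, HasFDerivAt G (fderiv ℝ G q) q := fun q hq =>
    ((hG.contDiffAt (hV.mem_nhds hq)).differentiableAt (by simp)).hasFDerivAt
  have hΓd : ∀ q ∈ V, fderiv ℝ (fun q => L (G q)) q =
      (L : ((Fin 4 → ℝ) × ℂ) →L[ℝ] Jet).comp (fderiv ℝ G q) := fun q hq =>
    (L.hasFDerivAt.comp q (hGd q hq)).fderiv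
  refine PairPDE.exists_solvesConformal hS hU hτ hV hVU (Γ := fun q => L (G q))
    (L.contDiff.comp_contDiffOn hG) ?_ (c := fun v => L (0, v)) ?_
  · intro q hq
    obtain ⟨y, hy, rfl⟩ := hZ.bijOn.surjOn hq
    have hF := ((hZ.contDiffOn.contDiffAt (hZ.isOpen.mem_nhds hy)).differentiableAt
      (by simp)).hasFDerivAt
    have h1 := ((hGd _ hq).comp y hF).unique ((hasFDerivAt_id y).congr_of_eventuallyEq (by
      filter_upwards [hZ.isOpen.mem_nhds hy] with z hz using hGF z hz))
    intro h0
    set F' := fderiv ℝ (fun y : (Fin 4 → ℝ) × ℂ => lift (fun z => Z (y.1, z)) y.2) y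
    -- The derivative of the lift, composed with L⁻¹, is a right inverse of the derivative of L ∘ G,
    -- so the determinant of the latter cannot vanish.
    have h2 : (fderiv ℝ (fun q => L (G q)) (lift (fun z => Z (y.1, z)) y.2)).comp
        (F'.comp (L.symm : Jet →L[ℝ] ((Fin 4 → ℝ) × ℂ))) = ContinuousLinearMap.id ℝ Jet := by
      rw [hΓd _ hq]
      apply ContinuousLinearMap.ext
      intro h
      have h3 := congrArg (fun A => L (A (L.symm h))) h1
      simpa using h3
    have h4 := congrArg ContinuousLinearMap.det h2
    rw [ContinuousLinearMap.det, ContinuousLinearMap.toLinearMap_comp, LinearMap.det_comp] at h4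
    rw [ContinuousLinearMap.det] at h0
    rw [h0, zero_mul] at h4
    simp [ContinuousLinearMap.det] at h4
  · intro q hq v
    obtain ⟨⟨x, s⟩, hy, rfl⟩ := hZ.bijOn.surjOn hq
    have hZx := hZ.isSolution x
    have hl := hZx.hasFDerivAt_lift hS hU hVU (s := s) hy
    have h1 := ((hGd _ hq).comp s hl).unique
      ((hasFDerivAt_prodMk_right x s).congr_of_eventuallyEq (by
        filter_upwards [hZx.isOpen.mem_nhds hy] with z hz using hGF (x, z) hz))
    rw [hΓd _ hq]
    exact congrArg (fun A => L (A v)) h1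

theorem IsAdmissible.exists_local_solvesConformal {U : Set Jet} {S : Jet → ℂ} {τ : TetradParams}
    (hS : IsAdmissible U S) (hU : IsOpen U) (hτ : τ.Regular U) {p : Jet} (hp : p ∈ U) :
    ∃ V : Set Jet, IsOpen V ∧ p ∈ V ∧ V ⊆ U ∧
      ∃ Φ : Jet → ℝ, ContDiffOn ℝ ∞ Φ V ∧ (∀ q ∈ V, 0 < Φ q) ∧ SolvesConformal S τ V Φ := by
  obtain ⟨N, hN, hpN, F, hF, -, hF0, hFd⟩ := exists_commuting_flow (flowField S) hU
    (hS.contDiffOn_flowField hU) hp (fun p hp v w => hS.flowField_comm hU hp v w)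
  let csL : Jet →L[ℝ] ℂ := (ContinuousLinearMap.snd ℝ ℝ ℂ).comp
    ((ContinuousLinearMap.snd ℝ ℂ (ℝ × ℂ)).comp (ContinuousLinearMap.snd ℝ ℝ (ℂ × ℝ × ℂ)))
  let ins : ℂ →L[ℝ] Jet := (ContinuousLinearMap.inr ℝ ℝ (ℂ × ℝ × ℂ)).comp
    ((ContinuousLinearMap.inr ℝ ℂ (ℝ × ℂ)).comp (ContinuousLinearMap.inr ℝ ℝ ℂ))
  have hci : ∀ w, csL (ins w) = w := fun w => rfl
  have hcX : ∀ q w, csL (flowField S q w) = w := fun q w => rfl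
  let pr : Jet →L[ℝ] Jet := ContinuousLinearMap.id ℝ Jet - ins.comp csL
  -- The second entry is the amount of flow that carries q back to the slice s = s(p).
  let j : Jet → Jet × ℂ := fun q => (q, csL p - csL q)
  have hj : ContDiff ℝ ∞ j := contDiff_id.prodMk (contDiff_const.sub csL.contDiff)
  have hj' : ∀ q, HasFDerivAt j ((ContinuousLinearMap.id ℝ Jet).prod (-csL)) q := fun q =>
    (hasFDerivAt_id q).prodMk (csL.hasFDerivAt.const_sub (csL p))
  have hjp : j p = (p, 0) := by simp [j]
  -- The s component of the point reached on the slice is discarded by `pr` and replaced by s(q).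
  -- The other components should be constant along the integral surfaces.
  let Γ : Jet → Jet := fun q => pr (F (j q)) + ins (csL q)
  set V₀ : Set Jet := U ∩ j ⁻¹' N with hV₀
  have hV₀o : IsOpen V₀ := hU.inter (hN.preimage hj.continuous)
  have hpV₀ : p ∈ V₀ := ⟨hp, by rw [Set.mem_preimage, hjp]; exact hpN⟩
  have hΓ : ContDiffOn ℝ ∞ Γ V₀ :=
    (pr.contDiff.comp_contDiffOn (hF.comp hj.contDiffOn fun q hq => hq.2)).add
      (ins.contDiff.comp csL.contDiff).contDiffOn
  have hFn : ∀ π ∈ N, HasFDerivAt F (fderiv ℝ F π) π := fun π hπ =>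
    ((hF.contDiffAt (hN.mem_nhds hπ)).differentiableAt (by simp)).hasFDerivAt
  have hΓd : ∀ q ∈ V₀, ∀ h, fderiv ℝ Γ q h =
      pr (fderiv ℝ F (j q) (h, -csL h)) + ins (csL h) := by
    intro q hq h
    have h1 := (pr.hasFDerivAt.comp q ((hFn _ hq.2).comp q (hj' q))).add
      (ins.comp csL).hasFDerivAt
    exact congrArg (fun A => A h) h1.fderiv
  have hc : ∀ q ∈ V₀, ∀ v, fderiv ℝ Γ q (flowField S q v) = ins v := by
    intro q hq v
    -- Moving q along the field for v while shortening the flow by v leaves the endpoint unchanged: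
    -- this is the derivative formula with ξ + η = 0.
    have h1 := hFd (j q) hq.2 v 1 (-1)
    rw [hΓd q hq, hcX]
    simp only [one_smul, neg_smul, add_neg_cancel, zero_smul, j] at h1
    rw [h1, map_zero, zero_add]
  have hdet : (fderiv ℝ Γ p).det ≠ 0 := by
    intro h0
    have h1 := LinearMap.bot_lt_ker_of_det_eq_zero h0
    obtain ⟨h, hh, hne⟩ := Submodule.exists_mem_ne_zero_of_ne_bot h1.ne'
    have h2 : fderiv ℝ Γ p h = 0 := hh
    rw [hΓd p hpV₀, hjp] at h2
    have h3 : csL h = 0 := by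
      have := congrArg csL h2
      simpa [pr, hci] using this
    -- F(q, 0) = q, so a kernel vector h, whose s component is already known to vanish, satisfies pr
    -- h = 0 and therefore h = 0.
    have h4 : fderiv ℝ F (p, 0) (h, 0) = h := by
      have h5 := (((hFn _ hpN).comp p (hasFDerivAt_prodMk_left p (0 : ℂ))).unique
        ((hasFDerivAt_id p).congr_of_eventuallyEq (by
          filter_upwards [(hN.preimage (show Continuous fun q : Jet => (q, (0 : ℂ)) by
            fun_prop)).mem_nhds hpN] with q hq using hF0 q hq)))
      exact congrArg (fun A => A h) h5
    rw [h3, neg_zero, h4] at h2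
    apply hne
    simpa [pr, h3] using h2
  have hcont : ContinuousOn (fun q => (fderiv ℝ Γ q).det) V₀ :=
    (ContinuousLinearMap.contDiff_det.comp_contDiffOn
      (hΓ.fderiv_of_isOpen hV₀o (m := ∞) (by simp))).continuousOn
  -- The Jacobian is nonzero at p and continuous; the neighbourhood is cut down to the open set
  -- where it does not vanish.
  refine ⟨V₀ ∩ (fun q => (fderiv ℝ Γ q).det) ⁻¹' {0}ᶜ,
    hcont.isOpen_inter_preimage hV₀o isOpen_compl_singleton, ⟨hpV₀, hdet⟩,
    fun q hq => hq.1.1, ?_⟩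
  exact PairPDE.exists_solvesConformal hS hU hτ
    (hcont.isOpen_inter_preimage hV₀o isOpen_compl_singleton) (fun q hq => hq.1.1)
    (hΓ.mono Set.inter_subset_left) (fun q hq => hq.2) (fun q hq => hc q hq.1)

end PairPDE
end

/-! ### The theorem -/

theorem mainTheorem3 (U : Set PairPDE.Jet) (hU : IsOpen U) (S : PairPDE.Jet → ℂ)
    (hS : PairPDE.IsAdmissible U S)
    (τ : PairPDE.TetradParams) (hτ : τ.Regular U)
    (hconn : ∃ (w : Fin 4 → Fin 4 → PairPDE.CForm) (A : PairPDE.CForm),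
      PairPDE.IsTorsionFreeWeyl U (PairPDE.tetrad S τ (fun _ => 1)) w A) :
    -- a solution exists near every point
    (∀ p ∈ U, ∃ V : Set PairPDE.Jet, IsOpen V ∧ p ∈ V ∧ V ⊆ U ∧
      ∃ Φ : PairPDE.Jet → ℝ, ContDiffOn ℝ ∞ Φ V ∧ (∀ q ∈ V, 0 < Φ q) ∧
        PairPDE.SolvesConformal S τ V Φ) ∧
    -- a solution exists on every region with coordinates from a four-parameter general solution
    (∀ V : Set PairPDE.Jet, IsOpen V → V ⊆ U →
      (∃ (O : Set ((Fin 4 → ℝ) × ℂ)) (Z : (Fin 4 → ℝ) × ℂ → ℝ),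
        PairPDE.IsGeneralSolution S V O Z) →
      ∃ Φ : PairPDE.Jet → ℝ, ContDiffOn ℝ ∞ Φ V ∧ (∀ q ∈ V, 0 < Φ q) ∧
        PairPDE.SolvesConformal S τ V Φ) ∧
    -- properties of every such choice of the conformal parameter, and its uniqueness
    (∀ V : Set PairPDE.Jet, IsOpen V → V ⊆ U →
      ∀ Φ : PairPDE.Jet → ℝ, ContDiffOn ℝ ∞ Φ V → (∀ q ∈ V, Φ q ≠ 0) →
        PairPDE.SolvesConformal S τ V Φ →
        (∃ (w : Fin 4 → Fin 4 → PairPDE.CForm) (A : PairPDE.CForm),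
          PairPDE.IsTorsionFreeWeyl V (PairPDE.tetrad S τ Φ) w A) ∧
        (∀ (w : Fin 4 → Fin 4 → PairPDE.CForm) (A : PairPDE.CForm),
          PairPDE.IsTorsionFreeWeyl V (PairPDE.tetrad S τ Φ) w A →
          ∀ q ∈ V, PairPDE.pair A (PairPDE.eS S) q = 0 ∧
            PairPDE.pair A (PairPDE.eSstar S) q = 0) ∧
        (∀ q ∈ V, ∀ I J,
          PairPDE.lie (PairPDE.eS S) (PairPDE.metric (PairPDE.tetrad S τ Φ)) q I J = 0 ∧
          PairPDE.lie (PairPDE.eSstar S) (PairPDE.metric (PairPDE.tetrad S τ Φ)) q I J = 0) ∧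
        (∀ Ψ : PairPDE.Jet → ℝ, ContDiffOn ℝ ∞ Ψ V →
          (PairPDE.SolvesConformal S τ V Ψ ↔
            ∃ ϖ : PairPDE.SolutionSpace S V → ℝ,
              ∀ q : V, Ψ q = ϖ (PairPDE.toSolution S V q) * Φ q))) := by
  refine ⟨fun p hp => hS.exists_local_solvesConformal hU hτ hp, ?_, ?_⟩
  · rintro V hV hVU ⟨O, Z, hZ⟩
    exact hZ.exists_solvesConformal hS hU hτ hV hVU
  · intro V hV hVU Φ hΦ hΦ0 hsol
    exact ⟨PairPDE.exists_torsionFreeWeyl hS hU hτ hconn hV hVU hΦ hΦ0,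
      fun w A h q hq => PairPDE.weyl_form_eq_zero hS hU hτ hV hVU hΦ hΦ0 hsol h hq,
      fun q hq I J => PairPDE.lie_metric_eq_zero hS hU hτ hconn hV hVU hΦ hΦ0 hsol hq I J,
      fun Ψ hΨ => PairPDE.solvesConformal_iff_descends hS hU hV hVU hΦ hΦ0 hsol hΨ⟩
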